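/- Let $n\ge 1$, $x_0\in\mathbb R^n$, and let $\Lambda\subset\mathbb R^n\times\mathbb R^n$ be a set which near $(x_0,x_0)$ is a $C^\infty$ embedded submanifold of codimension one (the hypersurface case $k=n-1$) containing the diagonal, such that the differentials $D\pi_1,D\pi_2:T_p\Lambda\to\mathbb R^n$ of the two coordinate projections restricted to $\Lambda$ have rank $n$ at every point $p\in\Lambda$ near $(x_0,x_0)$. All objects are considered near $(x_0,x_0)$. Let $M_{x}=\{y:(x,y)\in\Lambda\}$. Let $\mathcal V_1$ (respectively $\mathcal V_2$) be the set of smooth sections of $T\Lambda$ that lie in the nullspace of $D\pi_2$ (respectively $D\pi_1$), and let $\mathfrak G(\Lambda)$ be the smallest $C^\infty(\Lambda)$-module of vector fields on $\Lambda$ that contains $\mathcal V_1\cup\mathcal V_2$ and is closed under Lie brackets. Condition $(\mathcal C_\Lambda)$ holds at $x_0$ if the values at $(x_0,x_0)$ of the elements of $\mathfrak G(\Lambda)$ span $T_{(x_0,x_0)}\Lambda$. A set $A$ is tangent to $B$ to infinite order at $p$ if, for every $N\in\mathbb N$, $\operatorname{distance}(q,B)=O(|q-p|^N)$ as $q\to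 p$, $q\in A$. (a) $(\mathcal C_\Lambda)$ holds at $x_0$ if and only if $M_{x_0}\times M_{x_0}$ is not tangent to $\Lambda$ to infinite order at $(x_0,x_0)$. (b) There exist smooth coordinates $x=(x',x_n)\in\mathbb R^{n-1}\times\mathbb R$ of $\mathbb R^n$ near $x_0$, with origin at $x_0$, in which $M_{x_0}$ coincides near $x_0$ with the hyperplane $\{x_n=0\}$. For any such coordinates, used on both factors of $\mathbb R^n\times\mathbb R^n$, there is a real-valued $C^\infty$ function $\phi(x,y')$ defined near $(0,0)\in\mathbb R^n\times\mathbb R^{n-1}$, with $\nabla\phi(0,0)=0$, such that near $(0,0)$ $$\Lambda=\{(x,y): x_n=y_n+\phi(x,y')\}.$$ (c) For any such coordinates and any $C^\infty$ function $\phi$ for which this representation of $\Lambda$ holds near $(0,0)$, $(\mathcal C_\Lambda)$ holds at $x_0$ if and only if there are multi-indices $\alpha,\beta\in\mathbb N^{n-1}$ such that $$\frac{\partial^{\alpha+\beta}\phi}{\partial (x')^\alpha\,\partial (y')^\beta}(0,0)\neq 0 .$$ -/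

import Mathlib

open Set Filter Topology Asymptotics
open scoped ContDiff

noncomputable section

/-- `ℝⁿ` with its Euclidean norm. -/
abbrev Eucl (n : ℕ) : Type := EuclideanSpace ℝ (Fin n)

/-- `f` is defined and of class `C^∞` in some open neighbourhood of `p` (its values elsewhere are
irrelevant). -/
def SmoothNear {X Y : Type*} [NormedAddCommGroup X] [NormedSpace ℝ X]
    [NormedAddCommGroup Y] [NormedSpace ℝ Y] (f : X → Y) (p : X) : Prop :=
  ∃ U : Set X, IsOpen U ∧ p ∈ U ∧ ContDiffOn ℝ ∞ f U

/-- Near `p`, the set `S` is an (embedded) `C^∞` submanifold of codimension one through `p`: it is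
the zero set of a smooth function with nonvanishing differential. -/
def IsSmoothHypersurfaceNear {X : Type*} [NormedAddCommGroup X] [NormedSpace ℝ X]
    (S : Set X) (p : X) : Prop :=
  p ∈ S ∧ ∃ (U : Set X) (g : X → ℝ), IsOpen U ∧ p ∈ U ∧ ContDiffOn ℝ ∞ g U ∧
    (∀ q ∈ U, fderiv ℝ g q ≠ 0) ∧ ∀ q ∈ U, (q ∈ S ↔ g q = 0)

/-- The tangent space at `p` of a submanifold `S` of a vector space, as a subspace of that vector
space: the vectors annihilated by the differential at `p` of every smooth function that is defined
near `p` and vanishes on `S`. -/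
def tangentSub {X : Type*} [NormedAddCommGroup X] [NormedSpace ℝ X] (S : Set X) (p : X) :
    Submodule ℝ X where
  carrier := {v | ∀ (f : X → ℝ) (U : Set X), IsOpen U → p ∈ U → ContDiffOn ℝ ∞ f U →
    (∀ q ∈ S ∩ U, f q = 0) → fderiv ℝ f p v = 0}
  add_mem' := by
    intro a b ha hb f U h1 h2 h3 h4
    rw [map_add, ha f U h1 h2 h3 h4, hb f U h1 h2 h3 h4, add_zero]
  zero_mem' := by
    intro f U _ _ _ _
    exact map_zero _
  smul_mem' := by
    intro c a ha f U h1 h2 h3 h4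
    rw [map_smul, ha f U h1 h2 h3 h4, smul_zero]

/-- The standing hypotheses of the double fibration formulation in the hypersurface case. Near
`(x₀, x₀)`, the set `Λ ⊆ ℝⁿ × ℝⁿ` is a smooth submanifold of codimension one that contains the
diagonal, and the differentials `Dπ₁, Dπ₂ : T_pΛ → ℝⁿ` of the two coordinate projections have
rank `n` at every point `p` of `Λ` near `(x₀, x₀)`. -/
structure IsIncidenceHypersurface {n : ℕ} (Λ : Set (Eucl n × Eucl n)) (x₀ : Eucl n) : Prop where
  hypersurface : IsSmoothHypersurfaceNear Λ (x₀, x₀)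
  diagonal : ∀ᶠ x in 𝓝 x₀, (x, x) ∈ Λ
  rank_fst : ∀ᶠ p in 𝓝 (x₀, x₀), p ∈ Λ →
    (tangentSub Λ p).map (LinearMap.fst ℝ (Eucl n) (Eucl n)) = ⊤
  rank_snd : ∀ᶠ p in 𝓝 (x₀, x₀), p ∈ Λ →
    (tangentSub Λ p).map (LinearMap.snd ℝ (Eucl n) (Eucl n)) = ⊤

/-- The manifold `M_x = {y : (x, y) ∈ Λ}`. -/
def fiberM {n : ℕ} (Λ : Set (Eucl n × Eucl n)) (x : Eucl n) : Set (Eucl n) :=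
  {y | (x, y) ∈ Λ}

/-! Smooth vector fields on `Λ` near `(x₀, x₀)` are represented by smooth vector fields of the
ambient space `ℝⁿ × ℝⁿ`, defined near `(x₀, x₀)`, that are tangent to `Λ` at the points of `Λ`.
Every smooth section of `TΛ` and every smooth function on `Λ` near `(x₀, x₀)` has such an
extension, and the restriction to `Λ` of the Lie bracket of two such fields is the bracket on `Λ`
of their restrictions. Different representatives of one field differ by a field vanishing on `Λ`,
and all the fields vanishing on `Λ` belong to both `𝒱₁` and `𝒱₂` below. -/

/-- `𝒱₁`: the smooth sections of `TΛ` that lie in the nullspace of `Dπ₂`. -/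
def fieldsV1 {n : ℕ} (Λ : Set (Eucl n × Eucl n)) (x₀ : Eucl n) :
    Set (Eucl n × Eucl n → Eucl n × Eucl n) :=
  {V | SmoothNear V (x₀, x₀) ∧
    ∀ᶠ p in 𝓝 (x₀, x₀), p ∈ Λ → V p ∈ tangentSub Λ p ∧ (V p).2 = 0}

/-- `𝒱₂`: the smooth sections of `TΛ` that lie in the nullspace of `Dπ₁`. -/
def fieldsV2 {n : ℕ} (Λ : Set (Eucl n × Eucl n)) (x₀ : Eucl n) :
    Set (Eucl n × Eucl n → Eucl n × Eucl n) :=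
  {V | SmoothNear V (x₀, x₀) ∧
    ∀ᶠ p in 𝓝 (x₀, x₀), p ∈ Λ → V p ∈ tangentSub Λ p ∧ (V p).1 = 0}

/-- `𝔊(Λ)`: the Lie algebra generated by `𝒱₁ ∪ 𝒱₂` as a `C^∞` module, that is, the smallest set of
vector fields that contains `𝒱₁ ∪ 𝒱₂` and is closed under sums, under multiplication by smooth
functions and under Lie brackets. -/
inductive LieAlgG {n : ℕ} (Λ : Set (Eucl n × Eucl n)) (x₀ : Eucl n) :
    (Eucl n × Eucl n → Eucl n × Eucl n) → Prop
  | of_V1 {V : Eucl n × Eucl n → Eucl n × Eucl n} (hV : V ∈ fieldsV1 Λ x₀) : LieAlgG Λ x₀ V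
  | of_V2 {V : Eucl n × Eucl n → Eucl n × Eucl n} (hV : V ∈ fieldsV2 Λ x₀) : LieAlgG Λ x₀ V
  | add {V W : Eucl n × Eucl n → Eucl n × Eucl n} (hV : LieAlgG Λ x₀ V) (hW : LieAlgG Λ x₀ W) :
      LieAlgG Λ x₀ (fun p => V p + W p)
  | smul {V : Eucl n × Eucl n → Eucl n × Eucl n} {f : Eucl n × Eucl n → ℝ}
      (hf : SmoothNear f (x₀, x₀)) (hV : LieAlgG Λ x₀ V) : LieAlgG Λ x₀ (fun p => f p • V p)
  | bracket {V W : Eucl n × Eucl n → Eucl n × Eucl n} (hV : LieAlgG Λ x₀ V)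
      (hW : LieAlgG Λ x₀ W) : LieAlgG Λ x₀ (VectorField.lieBracket ℝ V W)

/-- The curvature condition `(𝒞_Λ)` at `x₀`: `𝔊(Λ)` spans the entire tangent space to `Λ` at
`(x₀, x₀)`. -/
def CurvatureLambda {n : ℕ} (Λ : Set (Eucl n × Eucl n)) (x₀ : Eucl n) : Prop :=
  Submodule.span ℝ {v | ∃ V, LieAlgG Λ x₀ V ∧ V (x₀, x₀) = v} = tangentSub Λ (x₀, x₀)

/-- `A` is tangent to `B` to infinite order at `p`: for every `N`, the distance from `q ∈ A` to `B`
is `O(|q - p|^N)` as `q → p`. (On a product, the norm of Mathlib is the maximum norm, which is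
equivalent to the Euclidean one.) -/
def TangentToInfiniteOrder {X : Type*} [NormedAddCommGroup X] (A B : Set X) (p : X) : Prop :=
  ∀ N : ℕ, (fun q => Metric.infDist q B) =O[𝓝[A] p] (fun q => ‖q - p‖ ^ N)

/-- `Φ = (x', x_n)` is a smooth coordinate system of `ℝⁿ` near `x₀`, `n = k + 1`, with origin at
`x₀`, in which `M_{x₀}` coincides near `x₀` with the hyperplane `x_n = 0`. -/
structure IsStraightening {k : ℕ} (Λ : Set (Eucl (k + 1) × Eucl (k + 1))) (x₀ : Eucl (k + 1))
    (Φ : OpenPartialHomeomorph (Eucl (k + 1)) (Eucl k × ℝ)) : Prop where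
  mem_source : x₀ ∈ Φ.source
  smooth : ContDiffOn ℝ ∞ Φ Φ.source
  smooth_symm : ContDiffOn ℝ ∞ Φ.symm Φ.target
  origin : Φ x₀ = 0
  hyperplane : ∀ᶠ y in 𝓝 x₀, (y ∈ fiberM Λ x₀ ↔ (Φ y).2 = 0)

/-- In the product coordinates given by `Φ`, and near the origin, `Λ` is the hypersurface
`x_n = y_n + φ(x, y')` with a smooth function `φ` defined near `0`. -/
structure IsGraphFunction {k : ℕ} (Λ : Set (Eucl (k + 1) × Eucl (k + 1))) (x₀ : Eucl (k + 1))
    (Φ : OpenPartialHomeomorph (Eucl (k + 1)) (Eucl k × ℝ))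
    (φ : (Eucl k × ℝ) × Eucl k → ℝ) : Prop where
  smooth : SmoothNear φ 0
  graph : ∀ᶠ p in 𝓝 (x₀, x₀),
    (p ∈ Λ ↔ (Φ p.1).2 = (Φ p.2).2 + φ (Φ p.1, (Φ p.2).1))

/-- The derivative `∂_{e₁}^{α₁} ⋯ ∂_{e_k}^{α_k} f`, where `∂_e f` is the derivative of `f` in the
direction `e`. -/
def multiDeriv {X : Type*} [NormedAddCommGroup X] [NormedSpace ℝ X] {k : ℕ} (e : Fin k → X)
    (α : Fin k → ℕ) (f : X → ℝ) : X → ℝ :=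
  (List.finRange k).foldr (fun i h => (fun u : X → ℝ => fun p => fderiv ℝ u p (e i))^[α i] h) f

/-- The partial derivative `∂^{α+β} φ / ∂(x')^α ∂(y')^β` of a function of `((x', x_n), y')`. -/
def mixedPartial {k : ℕ} (α β : Fin k → ℕ) (φ : (Eucl k × ℝ) × Eucl k → ℝ) :
    (Eucl k × ℝ) × Eucl k → ℝ :=
  multiDeriv (fun i => ((EuclideanSpace.single i (1 : ℝ), 0), 0)) α
    (multiDeriv (fun j => ((0, 0), EuclideanSpace.single j (1 : ℝ))) β φ)

end

/-! Write `K` for the hyperplane `x_n = 0` in the space of parameters `s = (x, y')` of `Λ`. The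
curvature condition, the failure of infinite-order tangency and the nonvanishing of some mixed
partial all say that the restriction of `φ` to `K` is not flat at `0`. Flatness is encoded by
`VanishesAlong (horizontal k) m φ` for all `m`.

Tangency: a point of `M_{x₀} × M_{x₀}` has `x_n = y_n = 0`, and its distance to `Λ` is comparable to
`|φ(x', 0, y')|`. So tangency means `φ = O(|s|^N)` on `K` for every `N`, which is flatness
(`vanishesAlong_iff_isBigO_pow`). The mixed partials are the derivatives along `K`
(`forall_vanishesAlong_horizontal_iff`).

Curvature: in the parameters, `𝒱₂` is generated by the `∂_{y'}` and `𝒱₁` by the fields `X_x = ∂_x +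
a_x ∂_n` with `a_x = ∂_x φ / (1 - ∂_n φ)`. If `φ` is flat along `K`, so is the `∂_n` component of
every field of `𝔊(Λ)`: this property passes through sums, multiples and brackets. Hence all values
at `0` lie in `K` (`not_curvatureLambda_of_vanishesAlong`).

Conversely, if the condition fails, every field `f ∂_n` in `𝔊(Λ)` has `f(0) = 0`, since the
generators already span `K` at `0`. Such fields arise as `(∂_y a_x) ∂_n = [∂_y, X_x]`, and further
brackets replace `f` by `∂_y f` or `X_x f - f ∂_n a_x`. Knowing that `φ` vanishes to some order
makes `X_x` close to `∂_x`, and so gives vanishing of `∂_y ∂_x φ`. Two integrations recover `φ` to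
one order more, because `φ(0, y') = 0` (this is `M_{x₀}`) and `φ(x, x') = 0` (this is the diagonal);
see `vanishesAlong_of_not_curvatureLambda`. The same two identities give `∇φ(0, 0) = 0`.

Existence of the coordinates and of `φ` is the inverse function theorem, applied to a defining
function whose differential along the fibre is nonzero. -/

section SmoothGerms

/-! ### Germs of smooth maps. -/

theorem minSmoothness_two_le_infty : minSmoothness ℝ 2 ≤ ∞ := by
  simp only [minSmoothness_of_isRCLikeNormedField]
  exact WithTop.coe_le_coe.2 (le_top : (2 : ℕ∞) ≤ ⊤)

variable {X Y Z : Type*} [NormedAddCommGroup X] [NormedSpace ℝ X]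
  [NormedAddCommGroup Y] [NormedSpace ℝ Y] [NormedAddCommGroup Z] [NormedSpace ℝ Z]

theorem smoothNear_iff {f : X → Y} {p : X} :
    SmoothNear f p ↔ ∀ᶠ q in 𝓝 p, ContDiffAt ℝ ∞ f q := by
  constructor
  · rintro ⟨U, hU, hp, h⟩
    filter_upwards [hU.mem_nhds hp] with q hq using h.contDiffAt (hU.mem_nhds hq)
  · intro h
    obtain ⟨U, h1, h2, h3⟩ := eventually_nhds_iff.1 h
    exact ⟨U, h2, h3, fun q hq => (h1 q hq).contDiffWithinAt⟩

theorem ContDiff.smoothNear {f : X → Y} (h : ContDiff ℝ ∞ f) (p : X) : SmoothNear f p :=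
  smoothNear_iff.2 (Eventually.of_forall fun _ => h.contDiffAt)

theorem ContDiffOn.smoothNear {f : X → Y} {U : Set X} (h : ContDiffOn ℝ ∞ f U) (hU : IsOpen U)
    {p : X} (hp : p ∈ U) : SmoothNear f p := ⟨U, hU, hp, h⟩

namespace SmoothNear

variable {f g : X → Y} {p : X}

theorem eventually (h : SmoothNear f p) : ∀ᶠ q in 𝓝 p, ContDiffAt ℝ ∞ f q := smoothNear_iff.1 h

theorem eventually_diff (h : SmoothNear f p) : ∀ᶠ q in 𝓝 p, DifferentiableAt ℝ f q :=
  h.eventually.mono fun _ hq => hq.differentiableAt (by simp)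

theorem contDiffAt (h : SmoothNear f p) : ContDiffAt ℝ ∞ f p := h.eventually.self_of_nhds

theorem differentiableAt (h : SmoothNear f p) : DifferentiableAt ℝ f p :=
  h.contDiffAt.differentiableAt (by simp)

theorem continuousAt (h : SmoothNear f p) : ContinuousAt f p := h.contDiffAt.continuousAt

theorem congr (h : SmoothNear f p) (hfg : f =ᶠ[𝓝 p] g) : SmoothNear g p := by
  rw [smoothNear_iff]
  filter_upwards [h.eventually, hfg.eventuallyEq_nhds] with q h1 h2
    using h1.congr_of_eventuallyEq h2.symm

theorem add (hf : SmoothNear f p) (hg : SmoothNear g p) : SmoothNear (fun q => f q + g q) p := by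
  rw [smoothNear_iff]
  filter_upwards [hf.eventually, hg.eventually] with q h1 h2 using h1.add h2

theorem sub (hf : SmoothNear f p) (hg : SmoothNear g p) : SmoothNear (fun q => f q - g q) p := by
  rw [smoothNear_iff]
  filter_upwards [hf.eventually, hg.eventually] with q h1 h2 using h1.sub h2

theorem smul {c : X → ℝ} (hc : SmoothNear c p) (hf : SmoothNear f p) :
    SmoothNear (fun q => c q • f q) p := by
  rw [smoothNear_iff]
  filter_upwards [hc.eventually, hf.eventually] with q h1 h2 using h1.smul h2

theorem mul {c d : X → ℝ} (hc : SmoothNear c p) (hd : SmoothNear d p) :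
    SmoothNear (fun q => c q * d q) p := by
  rw [smoothNear_iff]
  filter_upwards [hc.eventually, hd.eventually] with q h1 h2 using h1.mul h2

theorem inv {c : X → ℝ} (hc : SmoothNear c p) (h0 : c p ≠ 0) :
    SmoothNear (fun q => (c q)⁻¹) p := by
  rw [smoothNear_iff]
  filter_upwards [hc.eventually, hc.continuousAt.eventually_ne h0] with q h1 h2 using h1.inv h2

theorem prodMk {g : X → Z} (hf : SmoothNear f p) (hg : SmoothNear g p) :
    SmoothNear (fun q => (f q, g q)) p := by
  rw [smoothNear_iff]
  filter_upwards [hf.eventually, hg.eventually] with q h1 h2 using h1.prodMk h2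

theorem fst {f : X → Y × Z} (hf : SmoothNear f p) : SmoothNear (fun q => (f q).1) p := by
  rw [smoothNear_iff]
  filter_upwards [hf.eventually] with q h1 using h1.fst

theorem snd {f : X → Y × Z} (hf : SmoothNear f p) : SmoothNear (fun q => (f q).2) p := by
  rw [smoothNear_iff]
  filter_upwards [hf.eventually] with q h1 using h1.snd

theorem comp {g : Y → Z} {y : Y} (hg : SmoothNear g y) (hf : SmoothNear f p) (hy : f p = y) :
    SmoothNear (fun q => g (f q)) p := by
  subst hy
  rw [smoothNear_iff]
  filter_upwards [hf.eventually, hf.continuousAt.eventually hg.eventually] with q h1 h2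
    using h2.comp q h1

theorem clm (L : Y →L[ℝ] Z) (hf : SmoothNear f p) : SmoothNear (fun q => L (f q)) p :=
  (L.contDiff.smoothNear (f p)).comp hf rfl

theorem fderiv (hf : SmoothNear f p) : SmoothNear (_root_.fderiv ℝ f) p := by
  rw [smoothNear_iff]
  filter_upwards [hf.eventually] with q h1 using h1.fderiv_right (by simp)

theorem clm_apply {A : X → Y →L[ℝ] Z} (hA : SmoothNear A p) (hf : SmoothNear f p) :
    SmoothNear (fun q => A q (f q)) p := by
  rw [smoothNear_iff]
  filter_upwards [hA.eventually, hf.eventually] with q h1 h2 using h1.clm_apply h2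

theorem const (c : Y) : SmoothNear (fun _ : X => c) p := contDiff_const.smoothNear p

theorem id : SmoothNear (fun q : X => q) p := contDiff_id.smoothNear p

theorem dirDeriv (hf : SmoothNear f p) (v : X) : SmoothNear (fun q => _root_.fderiv ℝ f q v) p :=
  hf.fderiv.clm_apply (const v)

/-- The derivatives of a smooth function in two directions commute. -/
theorem dirDeriv_comm (hf : SmoothNear f p) (v w : X) :
    (fun q => _root_.fderiv ℝ (fun q => _root_.fderiv ℝ f q v) q w) =ᶠ[𝓝 p]
      fun q => _root_.fderiv ℝ (fun q => _root_.fderiv ℝ f q w) q v := by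
  filter_upwards [hf.eventually, hf.fderiv.eventually_diff] with q h1 h2
  have h3 := h1.isSymmSndFDerivAt minSmoothness_two_le_infty
  rw [fderiv_clm_apply h2 (differentiableAt_const _),
    fderiv_clm_apply h2 (differentiableAt_const _)]
  simpa using h3 w v

end SmoothNear

end SmoothGerms

/-! ### Order of vanishing at the origin along a subspace. -/

section Vanishing

variable {X : Type*} [NormedAddCommGroup X] [NormedSpace ℝ X]

/-- A function that vanishes on a subspace has vanishing derivatives along this subspace. -/
theorem eventually_fderiv_eq_zero_of_eqOn {K : Submodule ℝ X} {u : X → ℝ} (hu : SmoothNear u 0)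
    (h : ∀ᶠ p in 𝓝 0, p ∈ K → u p = 0) {a : X} (ha : a ∈ K) :
    ∀ᶠ p in 𝓝 0, p ∈ K → fderiv ℝ u p a = 0 := by
  filter_upwards [hu.eventually_diff, eventually_eventually_nhds.2 h] with p h1 h2 hp
  have h3 : HasLineDerivAt ℝ u (fderiv ℝ u p a) p a := h1.hasFDerivAt.hasLineDerivAt a
  have h4 : Tendsto (fun t : ℝ => p + t • a) (𝓝 0) (𝓝 p) := by
    have : ContinuousAt (fun t : ℝ => p + t • a) 0 := by fun_prop
    simpa [ContinuousAt] using this.tendsto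
  have h5 : (fun t : ℝ => u (p + t • a)) =ᶠ[𝓝 0] fun _ => 0 := by
    filter_upwards [h4.eventually h2] with t ht
    exact ht (K.add_mem hp (K.smul_mem _ ha))
  exact (HasDerivAt.congr_of_eventuallyEq h3 h5.symm).unique (hasDerivAt_const (0 : ℝ) (0 : ℝ))

/-- All derivatives of order less than `m` of `u` at `0` in directions of `K` vanish. -/
def VanishesAlong (K : Submodule ℝ X) : ℕ → (X → ℝ) → Prop
  | 0, _ => True
  | m + 1, u => u 0 = 0 ∧ ∀ v ∈ K, VanishesAlong K m (fun p => fderiv ℝ u p v)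

namespace VanishesAlong

variable {K : Submodule ℝ X} {m : ℕ} {u w : X → ℝ}

theorem congr (h : VanishesAlong K m u) (huw : u =ᶠ[𝓝 (0 : X)] w) : VanishesAlong K m w := by
  induction m generalizing u w with
  | zero => trivial
  | succ m ih =>
    refine ⟨huw.self_of_nhds ▸ h.1, fun v hv => ih (h.2 v hv) ?_⟩
    exact (huw.fderiv (𝕜 := ℝ)).mono fun p hp => congrArg (fun A : X →L[ℝ] ℝ => A v) hp

theorem of_succ (h : VanishesAlong K (m + 1) u) : VanishesAlong K m u := by
  induction m generalizing u with
  | zero => trivial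
  | succ m ih => exact ⟨h.1, fun v hv => ih (h.2 v hv)⟩

theorem mono (h : VanishesAlong K m u) {n : ℕ} (hn : n ≤ m) : VanishesAlong K n u := by
  induction m, hn using Nat.le_induction with
  | base => exact h
  | succ m _ ih => exact ih h.of_succ

theorem zero (m : ℕ) : VanishesAlong K m (fun _ : X => (0 : ℝ)) := by
  induction m with
  | zero => trivial
  | succ m ih => exact ⟨rfl, fun v _ => by simpa using ih⟩

theorem add (h : VanishesAlong K m u) (h' : VanishesAlong K m w) (hu : SmoothNear u 0)
    (hw : SmoothNear w 0) : VanishesAlong K m (fun p => u p + w p) := by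
  induction m generalizing u w with
  | zero => trivial
  | succ m ih =>
    refine ⟨by simp [h.1, h'.1], fun v hv => ?_⟩
    refine (ih (h.2 v hv) (h'.2 v hv) (hu.dirDeriv v) (hw.dirDeriv v)).congr ?_
    filter_upwards [hu.eventually_diff, hw.eventually_diff] with p h1 h2
    rw [fderiv_fun_add h1 h2]; rfl

theorem mul (h : VanishesAlong K m u) (hu : SmoothNear u 0) {c : X → ℝ} (hc : SmoothNear c 0) :
    VanishesAlong K m (fun p => c p * u p) := by
  induction m generalizing u c with
  | zero => trivial
  | succ m ih =>
    refine ⟨by simp [h.1], fun v hv => ?_⟩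
    refine ((ih (h.2 v hv) (hu.dirDeriv v) hc).add (ih h.of_succ hu (hc.dirDeriv v))
      (hc.mul (hu.dirDeriv v)) ((hc.dirDeriv v).mul hu)).congr ?_
    filter_upwards [hu.eventually_diff, hc.eventually_diff] with p h1 h2
    rw [fderiv_fun_mul h2 h1]
    simp [mul_comm]

theorem sub (h : VanishesAlong K m u) (h' : VanishesAlong K m w) (hu : SmoothNear u 0)
    (hw : SmoothNear w 0) : VanishesAlong K m (fun p => u p - w p) := by
  refine (h.add (h'.mul hw (SmoothNear.const (-1))) hu ((SmoothNear.const (-1)).mul hw)).congr ?_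
  exact Eventually.of_forall fun p => by ring

/-- A variable field with values in `K` costs one order, like a constant direction: `∂_v(Du·V) =
D(∂_v u)·V + Du·(∂_v V)`, and both terms have the same shape with one order less to prove. -/
theorem fderiv_apply (h : VanishesAlong K (m + 1) u) (hu : SmoothNear u 0) {V : X → X}
    (hV : SmoothNear V 0) (hVK : ∀ᶠ p in 𝓝 0, V p ∈ K) (hK : IsClosed (K : Set X)) :
    VanishesAlong K m (fun p => fderiv ℝ u p (V p)) := by
  induction m generalizing u V with
  | zero => trivial
  | succ m ih =>
    refine ⟨(h.2 _ hVK.self_of_nhds).1, fun v hv => ?_⟩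
    -- A limit of difference quotients of a `K`-valued map stays in the closed subspace `K`.
    have hDV : ∀ᶠ p in 𝓝 0, fderiv ℝ V p v ∈ K := by
      filter_upwards [hV.eventually_diff, eventually_eventually_nhds.2 hVK] with p h1 h2
      have h3 : Tendsto (fun t : ℝ => t⁻¹ • (V (p + t • v) - V p)) (𝓝[≠] 0) (𝓝 (fderiv ℝ V p v)) :=
        (h1.hasFDerivAt.hasLineDerivAt v).tendsto_slope_zero
      have h4 : Tendsto (fun t : ℝ => p + t • v) (𝓝[≠] 0) (𝓝 p) := by
        have : ContinuousAt (fun t : ℝ => p + t • v) 0 := by fun_prop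
        simpa [ContinuousAt] using this.tendsto.mono_left nhdsWithin_le_nhds
      refine hK.mem_of_tendsto h3 ?_
      filter_upwards [h4.eventually h2] with t ht
      exact K.smul_mem _ (K.sub_mem ht h2.self_of_nhds)
    refine ((ih (h.2 v hv) (hu.dirDeriv v) hV hVK).add (ih h.of_succ hu (hV.dirDeriv v) hDV)
      ((hu.dirDeriv v).fderiv.clm_apply hV) (hu.fderiv.clm_apply (hV.dirDeriv v))).congr ?_
    filter_upwards [hu.eventually, hu.fderiv.eventually_diff, hV.eventually_diff] with p h1 h2 h3
    rw [fderiv_clm_apply h2 h3, fderiv_clm_apply h2 (differentiableAt_const _)]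
    have := h1.isSymmSndFDerivAt minSmoothness_two_le_infty
    simp [this.eq v (V p), add_comm]

/-- If `u` vanishes on `K₁` and its derivatives in the directions of `K₂` vanish to order `m` along
`K₁ ⊔ K₂`, then `u` vanishes to order `m + 1`. -/
theorem of_eqOn {K₁ K₂ : Submodule ℝ X} (hK : K ≤ K₁ ⊔ K₂) (hK₁ : K₁ ≤ K) (hu : SmoothNear u 0)
    (h₁ : ∀ᶠ p in 𝓝 0, p ∈ K₁ → u p = 0)
    (h₂ : ∀ v ∈ K₂, VanishesAlong K m (fun p => fderiv ℝ u p v)) : VanishesAlong K (m + 1) u := by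
  induction m generalizing u with
  | zero => exact ⟨h₁.self_of_nhds K₁.zero_mem, fun v hv => trivial⟩
  | succ m ih =>
    refine ⟨h₁.self_of_nhds K₁.zero_mem, fun v hv => ?_⟩
    obtain ⟨a, ha, b, hb, rfl⟩ := Submodule.mem_sup.1 (hK hv)
    -- For `a ∈ K₁` the function `∂_a u` again vanishes on `K₁`, and its derivatives along `K₂` lose
    -- one order because `∂_a` and `∂_b` commute; so the induction hypothesis applies to it.
    have key : VanishesAlong K (m + 1) (fun p => fderiv ℝ u p a) := by
      refine ih (hu.dirDeriv a) ?_ fun v hv => ?_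
      · exact eventually_fderiv_eq_zero_of_eqOn hu h₁ ha
      · exact ((h₂ v hv).2 a (hK₁ ha)).congr (hu.dirDeriv_comm v a)
    refine (key.add (h₂ b hb) (hu.dirDeriv a) (hu.dirDeriv b)).congr ?_
    exact Eventually.of_forall fun p => by simp

end VanishesAlong

end Vanishing

/-! ### Flatness along a subspace versus decay faster than every power. -/

section FlatIffBigO

variable {X : Type*} [NormedAddCommGroup X] [NormedSpace ℝ X] {K : Submodule ℝ X} {u : X → ℝ}

/-- Derivatives along a basis of `K` are again flat, hence `O(‖q‖ ^ N)` by induction; the mean value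
inequality on the segment from `0` to `q` gains one power. -/
theorem isBigO_pow_of_vanishesAlong [FiniteDimensional ℝ K] (hu : SmoothNear u 0)
    (h : ∀ m, VanishesAlong K m u) (N : ℕ) : u =O[𝓝[K] 0] fun q => ‖q‖ ^ N := by
  induction N generalizing u with
  | zero =>
    simpa using (hu.continuousAt.tendsto.isBigO_one ℝ).mono nhdsWithin_le_nhds
  | succ N ih =>
    let b := Module.finBasis ℝ K
    have h1 : (fun p => ∑ i, ‖fderiv ℝ u p (b i)‖) =O[𝓝[K] 0] fun q => ‖q‖ ^ N :=
      IsBigO.fun_sum fun i _ => (ih (hu.dirDeriv (b i))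
        fun m => (h (m + 1)).2 _ (b i).2).norm_left
    obtain ⟨C, hC⟩ := h1.bound
    obtain ⟨M, hM⟩ : ∃ M : ℝ, ∀ i, ∀ q : K, |b.repr q i| ≤ M * ‖q‖ := by
      refine ⟨∑ i, ‖LinearMap.toContinuousLinearMap (b.coord i)‖, fun i q => ?_⟩
      have h2 := (LinearMap.toContinuousLinearMap (b.coord i)).le_opNorm q
      refine h2.trans (mul_le_mul_of_nonneg_right ?_ (norm_nonneg _))
      exact Finset.single_le_sum (f := fun i => ‖LinearMap.toContinuousLinearMap (b.coord i)‖)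
        (fun i _ => norm_nonneg (LinearMap.toContinuousLinearMap (b.coord i))) (Finset.mem_univ i)
    have hdu : ∀ p : X, ∀ q ∈ K, ‖fderiv ℝ u p q‖ ≤ M * ‖q‖ * ∑ i, ‖fderiv ℝ u p (b i)‖ := by
      intro p q hq
      have h2 : q = ∑ i, b.repr ⟨q, hq⟩ i • (b i : X) := by
        have h3 := congrArg K.subtype (b.sum_repr ⟨q, hq⟩)
        rw [map_sum] at h3
        exact h3.symm
      conv_lhs => rw [h2]
      rw [map_sum, Finset.mul_sum]
      refine norm_sum_le_of_le _ fun i _ => ?_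
      rw [map_smul, norm_smul]
      exact mul_le_mul_of_nonneg_right (hM i ⟨q, hq⟩) (norm_nonneg _)
    rw [eventually_nhdsWithin_iff] at hC
    obtain ⟨ε, hε, hball⟩ := Metric.eventually_nhds_iff.1 (hC.and hu.eventually_diff)
    refine IsBigO.of_bound (|M| * |C|) ?_
    rw [eventually_nhdsWithin_iff]
    refine Metric.eventually_nhds_iff.2 ⟨ε, hε, fun q hq hqK => ?_⟩
    rw [dist_zero_right] at hq
    have hsm : ∀ t ∈ Icc (0 : ℝ) 1, ‖t • q‖ ≤ ‖q‖ := fun t ht => by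
      rw [norm_smul, Real.norm_of_nonneg ht.1]
      exact mul_le_of_le_one_left (norm_nonneg _) ht.2
    have hd : ∀ t ∈ Icc (0 : ℝ) 1, HasDerivWithinAt (fun t : ℝ => u (t • q))
        (fderiv ℝ u (t • q) q) (Icc 0 1) t := fun t ht => by
      have h3 := (@hball (t • q) (by rw [dist_zero_right]; exact (hsm t ht).trans_lt hq)).2
      have h4 : HasDerivAt (fun t : ℝ => t • q) q t := by
        simpa using (hasDerivAt_id t).smul_const q
      exact (h3.hasFDerivAt.comp_hasDerivAt t h4).hasDerivWithinAt
    have h5 := norm_image_sub_le_of_norm_deriv_le_segment_01' (C := |M| * |C| * ‖q‖ ^ (N + 1)) hd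
      fun t ht => by
        have ht' := Ico_subset_Icc_self ht
        have h6 := (@hball (t • q) (by rw [dist_zero_right]; exact (hsm t ht').trans_lt hq)).1
          (K.smul_mem t hqK)
        rw [Real.norm_of_nonneg (Finset.sum_nonneg fun _ _ => norm_nonneg _), norm_pow,
          norm_norm] at h6
        calc _ ≤ _ := hdu (t • q) q hqK
          _ ≤ |M| * ‖q‖ * (|C| * ‖q‖ ^ N) := by
            gcongr
            · exact le_abs_self M
            · refine h6.trans ?_
              gcongr
              · exact le_abs_self C
              · exact hsm t ht'
          _ = _ := by ring
    simpa [(h 1).1] using h5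

/-- Compare with a difference quotient of step `t`: since `Du` is Lipschitz, `t ∂_v u(p) = u(p + t
v) - u(p) + O(t²)`. When `t` is a power of `‖p‖`, rapid decay of `u` makes the right side `O(t²)`,
so `∂_v u(p) = O(t)`. -/
theorem isBigO_pow_dirDeriv (hu : SmoothNear u 0) (h : ∀ N : ℕ, u =O[𝓝[K] 0] fun q => ‖q‖ ^ N)
    {v : X} (hv : v ∈ K) (N : ℕ) : (fun p => fderiv ℝ u p v) =O[𝓝[K] 0] fun q => ‖q‖ ^ N := by
  obtain ⟨L, U, hU, hL⟩ := (hu.fderiv.contDiffAt.of_le (m := 1) (by simp)).exists_lipschitzOnWith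
  obtain ⟨C, hC0, hC⟩ := (h (2 * (N + 1))).exists_nonneg
  have hC := eventually_nhdsWithin_iff.1 hC.bound
  obtain ⟨ε, hε, hball⟩ := Metric.eventually_nhds_iff.1 ((hC.and hu.eventually_diff).and hU)
  set B : ℝ := L * ‖v‖ ^ 2 + C * (1 + ‖v‖) ^ (2 * (N + 1)) + C with hB
  have hB0 : 0 ≤ B := by positivity
  set δ : ℝ := min 1 (ε / (1 + ‖v‖)) with hδ
  have hδ0 : 0 < δ := lt_min one_pos (by positivity)
  -- A radius `s ≥ ‖p‖` with `s > 0` replaces `‖p‖`, so that the step is positive even at `p = 0`.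
  have main : ∀ p ∈ K, ∀ s : ℝ, ‖p‖ ≤ s → 0 < s → s < δ → ‖fderiv ℝ u p v‖ ≤ B * s ^ (N + 1) := by
    intro p hp s hps hs hsδ
    have hs1 : s < 1 := hsδ.trans_le (min_le_left _ _)
    have hs2 : s * (1 + ‖v‖) < ε :=
      (lt_div_iff₀ (by positivity)).1 (hsδ.trans_le (min_le_right _ _))
    -- The exponent `N + 1` instead of `N` ensures `t ≤ s` also for `N = 0`, so `p + t v` has norm
    -- at most `(1 + ‖v‖) s`.
    set t : ℝ := s ^ (N + 1) with ht
    have ht0 : 0 < t := by positivity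
    have hts : t ≤ s := by
      rw [ht, pow_succ]
      exact mul_le_of_le_one_left hs.le (pow_le_one₀ hs.le hs1.le)
    have htv : ‖t • v‖ = t * ‖v‖ := by rw [norm_smul, Real.norm_of_nonneg ht0.le]
    have hptv : ‖p‖ + t * ‖v‖ ≤ s * (1 + ‖v‖) := by
      nlinarith [mul_le_mul_of_nonneg_right hts (norm_nonneg v)]
    have hsub : ∀ q ∈ Metric.closedBall p (t * ‖v‖), dist q 0 < ε := by
      intro q hq
      rw [mem_closedBall_iff_norm] at hq
      rw [dist_zero_right]
      calc ‖q‖ = ‖p + (q - p)‖ := by rw [add_sub_cancel]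
        _ ≤ ‖p‖ + ‖q - p‖ := norm_add_le _ _
        _ ≤ ‖p‖ + t * ‖v‖ := by gcongr
        _ < ε := hptv.trans_lt hs2
    have hpm : p ∈ Metric.closedBall p (t * ‖v‖) :=
      Metric.mem_closedBall_self (by positivity)
    have hqm : p + t • v ∈ Metric.closedBall p (t * ‖v‖) := by
      rw [mem_closedBall_iff_norm, add_sub_cancel_left, htv]
    have h1 := (convex_closedBall p (t * ‖v‖)).norm_image_sub_le_of_norm_hasFDerivWithin_le'
      (f := u) (f' := fderiv ℝ u) (φ := fderiv ℝ u p) (C := L * (t * ‖v‖))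
      (fun q hq => ((hball (hsub q hq)).1.2.hasFDerivAt).hasFDerivWithinAt)
      (fun q hq => by
        refine (hL.norm_sub_le (hball (hsub q hq)).2 (hball (hsub p hpm)).2).trans ?_
        gcongr
        exact mem_closedBall_iff_norm.1 hq) hpm hqm
    rw [add_sub_cancel_left, htv, map_smul] at h1
    have h2 : ‖u p‖ ≤ C * (t * t) := by
      refine ((hball (hsub p hpm)).1.1 hp).trans ?_
      rw [norm_pow, norm_norm, ht, ← pow_add, ← two_mul]
      gcongr
    have h3 : ‖u (p + t • v)‖ ≤ C * ((1 + ‖v‖) ^ (2 * (N + 1)) * (t * t)) := by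
      refine ((hball (hsub _ hqm)).1.1 (K.add_mem hp (K.smul_mem _ hv))).trans ?_
      rw [norm_pow, norm_norm, ht, ← pow_add, ← two_mul, mul_comm ((1 + ‖v‖) ^ _), ← mul_pow]
      gcongr
      refine (norm_add_le _ _).trans ?_
      rwa [htv]
    have h4 : t * ‖fderiv ℝ u p v‖ ≤ t * (B * t) := by
      calc t * ‖fderiv ℝ u p v‖ = ‖t • fderiv ℝ u p v‖ := by
            rw [norm_smul, Real.norm_of_nonneg ht0.le]
        _ = ‖(u (p + t • v) - u p) - (u (p + t • v) - u p - t • fderiv ℝ u p v)‖ := by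
            congr 1; ring
        _ ≤ (‖u (p + t • v)‖ + ‖u p‖) + L * (t * ‖v‖) * (t * ‖v‖) :=
            (norm_sub_le _ _).trans (add_le_add (norm_sub_le _ _) h1)
        _ ≤ _ := by rw [hB]; linarith
    exact le_of_mul_le_mul_left h4 ht0
  refine IsBigO.of_bound B ?_
  rw [eventually_nhdsWithin_iff]
  refine Metric.eventually_nhds_iff.2 ⟨δ, hδ0, fun p hp hpK => ?_⟩
  rw [dist_zero_right] at hp
  -- Let `s` decrease to `‖p‖`.
  have hlim : Tendsto (fun s : ℝ => B * s ^ (N + 1)) (𝓝[>] ‖p‖) (𝓝 (B * ‖p‖ ^ (N + 1))) :=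
    Tendsto.mono_left (by
      have : Continuous fun s : ℝ => B * s ^ (N + 1) := by fun_prop
      exact this.tendsto _) nhdsWithin_le_nhds
  have h5 : ‖fderiv ℝ u p v‖ ≤ B * ‖p‖ ^ (N + 1) := by
    refine ge_of_tendsto hlim ?_
    filter_upwards [Ioo_mem_nhdsGT hp] with s hs
    exact main p hpK s hs.1.le ((norm_nonneg p).trans_lt hs.1) hs.2
  refine h5.trans ?_
  rw [norm_pow, norm_norm, pow_succ]
  have : ‖p‖ ≤ 1 := hp.le.trans (min_le_left _ _)
  gcongr
  exact mul_le_of_le_one_right (by positivity) this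

theorem vanishesAlong_of_isBigO_pow (hu : SmoothNear u 0)
    (h : ∀ N : ℕ, u =O[𝓝[K] 0] fun q => ‖q‖ ^ N) (m : ℕ) : VanishesAlong K m u := by
  induction m generalizing u with
  | zero => trivial
  | succ m ih =>
    refine ⟨?_, fun v hv => ih (hu.dirDeriv v) fun N => isBigO_pow_dirDeriv hu h hv N⟩
    obtain ⟨C, hC⟩ := (h 1).bound
    have := hC.self_of_nhdsWithin K.zero_mem
    simpa using this

theorem vanishesAlong_iff_isBigO_pow [FiniteDimensional ℝ K] (hu : SmoothNear u 0) :
    (∀ m, VanishesAlong K m u) ↔ ∀ N : ℕ, u =O[𝓝[K] 0] fun q => ‖q‖ ^ N :=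
  ⟨isBigO_pow_of_vanishesAlong hu, vanishesAlong_of_isBigO_pow hu⟩

end FlatIffBigO

/-! ### Iterated directional derivatives and multi-indices. -/

noncomputable section MultiDeriv

variable {X : Type*} [NormedAddCommGroup X] [NormedSpace ℝ X] {f g : X → ℝ} {p : X}

/-- The derivative of `f` in the direction `v`. -/
def derivAlong (v : X) (f : X → ℝ) : X → ℝ := fun p => fderiv ℝ f p v

/-- The iterated derivative of `f` in the directions listed in `l`, each taken `α i` times. -/
def listDeriv {ι : Type*} (e : ι → X) (α : ι → ℕ) (l : List ι) (f : X → ℝ) : X → ℝ :=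
  l.foldr (fun i h => (derivAlong (e i))^[α i] h) f

theorem SmoothNear.derivAlong_iterate (hf : SmoothNear f p) (v : X) (n : ℕ) :
    SmoothNear ((derivAlong v)^[n] f) p := by
  induction n with
  | zero => exact hf
  | succ n ih => rw [Function.iterate_succ_apply']; exact ih.dirDeriv v

theorem derivAlong_congr (h : f =ᶠ[𝓝 p] g) (v : X) : derivAlong v f =ᶠ[𝓝 p] derivAlong v g :=
  (h.fderiv (𝕜 := ℝ)).mono fun _ hq => congrArg (fun A : X →L[ℝ] ℝ => A v) hq

theorem derivAlong_iterate_congr (h : f =ᶠ[𝓝 p] g) (v : X) (n : ℕ) :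
    (derivAlong v)^[n] f =ᶠ[𝓝 p] (derivAlong v)^[n] g := by
  induction n with
  | zero => exact h
  | succ n ih => simp only [Function.iterate_succ_apply']; exact derivAlong_congr ih v

theorem derivAlong_iterate_derivAlong (hf : SmoothNear f p) (v w : X) (n : ℕ) :
    (derivAlong v)^[n] (derivAlong w f) =ᶠ[𝓝 p] derivAlong w ((derivAlong v)^[n] f) := by
  induction n with
  | zero => rfl
  | succ n ih =>
    simp only [Function.iterate_succ_apply']
    exact (derivAlong_congr ih v).trans ((hf.derivAlong_iterate v n).dirDeriv_comm w v)

variable {ι : Type*} (e : ι → X) (α : ι → ℕ)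

theorem SmoothNear.iteratedListDeriv (hf : SmoothNear f p) (l : List ι) :
    SmoothNear (listDeriv e α l f) p := by
  induction l with
  | nil => exact hf
  | cons i l ih => exact ih.derivAlong_iterate _ _

theorem listDeriv_zero (l : List ι) : listDeriv e 0 l f = f := by
  induction l with
  | nil => rfl
  | cons i l ih => exact ih

theorem listDeriv_congr (h : f =ᶠ[𝓝 p] g) (l : List ι) :
    listDeriv e α l f =ᶠ[𝓝 p] listDeriv e α l g := by
  induction l with
  | nil => exact h
  | cons i l ih => exact derivAlong_iterate_congr ih _ _

theorem listDeriv_derivAlong (hf : SmoothNear f p) (l : List ι) (w : X) :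
    listDeriv e α l (derivAlong w f) =ᶠ[𝓝 p] derivAlong w (listDeriv e α l f) := by
  induction l with
  | nil => rfl
  | cons i l ih =>
    exact (derivAlong_iterate_congr ih _ _).trans
      (derivAlong_iterate_derivAlong (hf.iteratedListDeriv e α l) _ _ _)

theorem listDeriv_add_single [DecidableEq ι] (hf : SmoothNear f p) {l : List ι} (hl : l.Nodup)
    {i : ι} (hi : i ∈ l) :
    listDeriv e (α + Pi.single i 1) l f =ᶠ[𝓝 p] derivAlong (e i) (listDeriv e α l f) := by
  induction l with
  | nil => simp at hi
  | cons j l ih =>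
    rw [List.nodup_cons] at hl
    by_cases hij : i = j
    · subst hij
      -- The list has no repetition, so `i` does not occur in the tail and the raised exponent
      -- changes only the head.
      have h1 : ∀ t : List ι, i ∉ t → listDeriv e (α + Pi.single i 1) t f = listDeriv e α t f := by
        intro t ht
        induction t with
        | nil => rfl
        | cons a t iht =>
          rw [List.mem_cons, not_or] at ht
          change (derivAlong (e a))^[_] (listDeriv e _ t f) =
            (derivAlong (e a))^[_] (listDeriv e _ t f)
          rw [iht ht.2, Pi.add_apply, Pi.single_eq_of_ne (Ne.symm ht.1), add_zero]
      change (derivAlong (e i))^[_] (listDeriv e _ l f) =ᶠ[𝓝 p]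
        derivAlong (e i) ((derivAlong (e i))^[_] (listDeriv e _ l f))
      rw [h1 l hl.1, Pi.add_apply, Pi.single_eq_same, Function.iterate_succ_apply']
    · have h2 := ih hl.2 ((List.mem_cons.1 hi).resolve_left hij)
      change (derivAlong (e j))^[_] (listDeriv e _ l f) =ᶠ[𝓝 p]
        derivAlong (e i) ((derivAlong (e j))^[_] (listDeriv e _ l f))
      rw [Pi.add_apply, Pi.single_eq_of_ne (Ne.symm hij), add_zero]
      exact (derivAlong_iterate_congr h2 _ _).trans
        (derivAlong_iterate_derivAlong (hf.iteratedListDeriv e α l) _ _ _)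

theorem forall_vanishesAlong_listDeriv {K : Submodule ℝ X} (h : ∀ m, VanishesAlong K m f)
    (he : ∀ i, e i ∈ K) (l : List ι) (m : ℕ) : VanishesAlong K m (listDeriv e α l f) := by
  have h1 : ∀ (i : ι) (n : ℕ) (g : X → ℝ), (∀ m, VanishesAlong K m g) →
      ∀ m, VanishesAlong K m ((derivAlong (e i))^[n] g) := by
    intro i n g hg
    induction n with
    | zero => exact hg
    | succ n ih =>
      intro m
      rw [Function.iterate_succ_apply']
      exact (ih (m + 1)).2 _ (he i)
  induction l generalizing m with
  | nil => exact h m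
  | cons i l ih => exact h1 i (α i) _ ih m

theorem VanishesAlong.succ_of_span {S : Set X} {K : Submodule ℝ X} (hK : K ≤ Submodule.span ℝ S)
    {m : ℕ} (hf : SmoothNear f 0) (h0 : f 0 = 0)
    (h : ∀ v ∈ S, VanishesAlong K m (fun p => fderiv ℝ f p v)) : VanishesAlong K (m + 1) f := by
  suffices key : ∀ v ∈ Submodule.span ℝ S, VanishesAlong K m (fun p => fderiv ℝ f p v) from
    ⟨h0, fun v hv => key v (hK hv)⟩
  intro v hv
  induction hv using Submodule.span_induction with
  | mem v hv => exact h v hv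
  | zero =>
    simpa using VanishesAlong.zero m
  | add v w _ _ h1 h2 =>
    simpa using h1.add h2 (hf.dirDeriv v) (hf.dirDeriv w)
  | smul c v _ h1 =>
    simpa using h1.mul (hf.dirDeriv v) (SmoothNear.const c)

end MultiDeriv

/-! ### Flatness along `x_n = 0` in terms of mixed partials. -/

noncomputable section Horizontal

/-- The hyperplane `x_n = 0` in the space of the `((x', x_n), y')`. -/
def horizontal (k : ℕ) : Submodule ℝ ((Eucl k × ℝ) × Eucl k) :=
  LinearMap.ker ((LinearMap.snd ℝ (Eucl k) ℝ).comp (LinearMap.fst ℝ (Eucl k × ℝ) (Eucl k)))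

variable {k : ℕ}

@[simp]
theorem mem_horizontal {p : (Eucl k × ℝ) × Eucl k} : p ∈ horizontal k ↔ p.1.2 = 0 := Iff.rfl

/-- The coordinate vector of `x_i`. -/
def baseDir (i : Fin k) : (Eucl k × ℝ) × Eucl k := ((EuclideanSpace.single i (1 : ℝ), 0), 0)

/-- The coordinate vector of `y_j`. -/
def fibreDir (j : Fin k) : (Eucl k × ℝ) × Eucl k := ((0, 0), EuclideanSpace.single j (1 : ℝ))

theorem horizontal_le_span : horizontal k ≤ Submodule.span ℝ
    (range (baseDir (k := k)) ∪ range (fibreDir (k := k))) := by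
  rintro ⟨⟨x, s⟩, y⟩ h
  obtain rfl : s = 0 := h
  have hE : ∀ x : Eucl k, x = ∑ i, x i • EuclideanSpace.single i (1 : ℝ) := fun x => by
    have := (EuclideanSpace.basisFun (Fin k) ℝ).sum_repr x
    simpa using this.symm
  have hx : (((x, 0), 0) : (Eucl k × ℝ) × Eucl k) =
      ∑ i, x i • baseDir i := by
    have := congrArg ((LinearMap.inl ℝ (Eucl k × ℝ) (Eucl k)).comp (LinearMap.inl ℝ (Eucl k) ℝ))
      (hE x)
    simp only [map_sum, map_smul] at this
    exact this
  have hy : (((0, 0), y) : (Eucl k × ℝ) × Eucl k) =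
      ∑ i, y i • fibreDir i := by
    have := congrArg (LinearMap.inr ℝ (Eucl k × ℝ) (Eucl k)) (hE y)
    simp only [map_sum, map_smul] at this
    exact this
  have hxy : (((x, 0), y) : (Eucl k × ℝ) × Eucl k) = ((x, 0), 0) + ((0, 0), y) := by simp
  rw [hxy, hx, hy]
  exact Submodule.add_mem _
    (Submodule.sum_mem _ fun i _ => Submodule.smul_mem _ _ (Submodule.subset_span (.inl ⟨i, rfl⟩)))
    (Submodule.sum_mem _ fun i _ => Submodule.smul_mem _ _ (Submodule.subset_span (.inr ⟨i, rfl⟩)))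

theorem mixedPartial_eq_listDeriv (α β : Fin k → ℕ) (φ : (Eucl k × ℝ) × Eucl k → ℝ) :
    mixedPartial α β φ =
      listDeriv baseDir α (List.finRange k)
        (listDeriv fibreDir β (List.finRange k) φ) := rfl

/-- Derivatives commute, so differentiating `φ` once more in a coordinate direction of the
hyperplane raises one entry of `α` or `β`; the hypothesis on all partials thus passes from `φ` to
its first derivatives. -/
theorem forall_vanishesAlong_horizontal_iff {φ : (Eucl k × ℝ) × Eucl k → ℝ} (hφ : SmoothNear φ 0) :
    (∀ m, VanishesAlong (horizontal k) m φ) ↔ ∀ α β : Fin k → ℕ, mixedPartial α β φ 0 = 0 := by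
  classical
  constructor
  · intro h α β
    rw [mixedPartial_eq_listDeriv]
    exact (forall_vanishesAlong_listDeriv _ α (forall_vanishesAlong_listDeriv _ β h
      (fun j => by simp [fibreDir]) _) (fun i => by simp [baseDir]) _ 1).1
  · intro h m
    induction m generalizing φ with
    | zero => trivial
    | succ m ih =>
      simp only [mixedPartial_eq_listDeriv] at h ih
      refine VanishesAlong.succ_of_span horizontal_le_span hφ ?_ ?_
      · simpa [listDeriv_zero] using h 0 0
      · rintro v (⟨i, rfl⟩ | ⟨j, rfl⟩)
        · refine ih (hφ.dirDeriv _) fun α β => ?_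
          refine Eq.trans ?_ (h (α + Pi.single i 1) β)
          rw [(listDeriv_add_single baseDir α (hφ.iteratedListDeriv fibreDir β (List.finRange k))
            (List.nodup_finRange k) (List.mem_finRange i)).self_of_nhds,
            ← (listDeriv_derivAlong baseDir α (hφ.iteratedListDeriv fibreDir β _) _ _).self_of_nhds]
          exact (listDeriv_congr baseDir α
            (listDeriv_derivAlong fibreDir β hφ _ _) _).self_of_nhds
        · refine ih (hφ.dirDeriv _) fun α β => ?_
          refine Eq.trans ?_ (h α (β + Pi.single j 1))
          refine (listDeriv_congr baseDir α ?_ _).self_of_nhds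
          exact (listDeriv_derivAlong fibreDir β hφ _ _).trans (listDeriv_add_single fibreDir β hφ
            (List.nodup_finRange k) (List.mem_finRange j)).symm

end Horizontal

/-! ### Tangent vectors and vector fields on a parametrized submanifold. -/

section LocalParametrization

variable {P X : Type*} [NormedAddCommGroup P] [NormedSpace ℝ P]
  [NormedAddCommGroup X] [NormedSpace ℝ X]

/-- Near `p₀`, the set `Λ` is the image of the smooth map `ψ`, which has the smooth left
inverse `ρ`. -/
structure IsLocalParam (Λ : Set X) (p₀ : X) (ψ : P → X) (ρ : X → P) : Prop where
  map_zero : ψ 0 = p₀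
  smooth : SmoothNear ψ 0
  smooth_inv : SmoothNear ρ p₀
  mem : ∀ᶠ s in 𝓝 0, ψ s ∈ Λ
  left_inv : ∀ᶠ s in 𝓝 0, ρ (ψ s) = s
  right_inv : ∀ᶠ p in 𝓝 p₀, p ∈ Λ → ψ (ρ p) = p

/-- The field `V` restricts on the image of `ψ` to the push-forward of the field `v`. -/
def IsRelated (ψ : P → X) (V : X → X) (v : P → P) : Prop :=
  ∀ᶠ s in 𝓝 0, V (ψ s) = fderiv ℝ ψ s (v s)

namespace IsLocalParam

variable {Λ : Set X} {p₀ : X} {ψ : P → X} {ρ : X → P} (h : IsLocalParam Λ p₀ ψ ρ)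
include h

theorem inv_zero : ρ p₀ = 0 := by rw [← h.map_zero, h.left_inv.self_of_nhds]

theorem tendsto : Tendsto ψ (𝓝 0) (𝓝 p₀) := by
  simpa [h.map_zero] using h.smooth.continuousAt.tendsto

theorem tendsto_inv : Tendsto ρ (𝓝 p₀) (𝓝 0) := by
  simpa [h.inv_zero] using h.smooth_inv.continuousAt.tendsto

theorem fderiv_inv_fderiv : ∀ᶠ s in 𝓝 0, ∀ v, fderiv ℝ ρ (ψ s) (fderiv ℝ ψ s v) = v := by
  filter_upwards [h.left_inv.eventually_nhds, h.smooth.eventually_diff,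
    h.tendsto.eventually h.smooth_inv.eventually_diff] with s h1 h2 h3 v
  have h4 : (fun s => ρ (ψ s)) =ᶠ[𝓝 s] fun s => s := h1
  have h5 := h4.fderiv_eq (𝕜 := ℝ)
  rw [fderiv_fun_comp s h3 h2] at h5
  simpa using congrArg (fun A : P →L[ℝ] P => A v) h5

/-- The functions `ℓ(q - ψ(ρ q))`, with `ℓ` a continuous functional, vanish on `Λ`; testing a
tangent vector `v` against them forces `v = Dψ(Dρ v)`. The other inclusion is the chain rule. -/
theorem mem_tangentSub_iff :
    ∀ᶠ s in 𝓝 0, ∀ v, v ∈ tangentSub Λ (ψ s) ↔ ∃ w, fderiv ℝ ψ s w = v := by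
  have hd : SmoothNear (fun q => q - ψ (ρ q)) p₀ :=
    SmoothNear.id.sub (h.smooth.comp h.smooth_inv h.inv_zero)
  obtain ⟨U, hU, hUo, hUp⟩ := eventually_nhds_iff.1 (hd.eventually.and h.right_inv)
  filter_upwards [h.tendsto.eventually (hUo.mem_nhds hUp), h.left_inv, h.smooth.eventually_diff,
    h.tendsto.eventually h.smooth_inv.eventually_diff, h.mem.eventually_nhds]
    with s hs h1 h2 h3 h4 v
  constructor
  · intro hv
    refine ⟨fderiv ℝ ρ (ψ s) v, ?_⟩
    have h5 : fderiv ℝ (fun q => q - ψ (ρ q)) (ψ s) v = v - fderiv ℝ ψ s (fderiv ℝ ρ (ψ s) v) := by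
      have h2' : DifferentiableAt ℝ ψ (ρ (ψ s)) := by rwa [h1]
      rw [fderiv_fun_sub differentiableAt_fun_id (DifferentiableAt.fun_comp' (ψ s) h2' h3),
        fderiv_fun_comp (ψ s) h2' h3, h1]
      simp
    have h6 : v - fderiv ℝ ψ s (fderiv ℝ ρ (ψ s) v) = 0 := by
      refine SeparatingDual.eq_zero_of_forall_dual_eq_zero (R := ℝ) fun ℓ => ?_
      have h7 := hv (fun q => ℓ (q - ψ (ρ q))) U hUo hs
        (ℓ.contDiff.comp_contDiffOn fun q hq => (hU q hq).1.contDiffWithinAt)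
        (fun q hq => by rw [(hU q hq.2).2 hq.1, sub_self, _root_.map_zero])
      rw [← h5]
      have h8 : DifferentiableAt ℝ (fun q => q - ψ (ρ q)) (ψ s) :=
        (hU _ hs).1.differentiableAt (by simp)
      have h9 := (ℓ.hasFDerivAt.comp (ψ s) h8.hasFDerivAt).fderiv
      change fderiv ℝ (fun q => ℓ (q - ψ (ρ q))) (ψ s) = _ at h9
      rw [h9] at h7
      simpa using h7
    exact (sub_eq_zero.1 h6).symm
  · rintro ⟨w, rfl⟩ f U hU hp hf hfΛ
    have h5 : (fun s => f (ψ s)) =ᶠ[𝓝 s] fun _ => 0 := by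
      filter_upwards [h4, h2.continuousAt.eventually (hU.mem_nhds hp)] with t h6 h7
        using hfΛ _ ⟨h6, h7⟩
    have h6 := h5.fderiv_eq (𝕜 := ℝ)
    rw [fderiv_fun_comp s ((hf.contDiffAt (hU.mem_nhds hp)).differentiableAt (by simp)) h2] at h6
    simpa using congrArg (fun A : P →L[ℝ] ℝ => A w) h6

theorem eventually_of_mem {Q : P → X → Prop} (hQ : ∀ᶠ s in 𝓝 0, Q s (ψ s)) :
    ∀ᶠ p in 𝓝 p₀, p ∈ Λ → Q (ρ p) p := by
  filter_upwards [h.right_inv, h.tendsto_inv.eventually hQ] with p h1 h2 hp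
  rwa [h1 hp] at h2

theorem eventually_param {Q : X → Prop} (hQ : ∀ᶠ p in 𝓝 p₀, p ∈ Λ → Q p) :
    ∀ᶠ s in 𝓝 0, Q (ψ s) := by
  filter_upwards [h.tendsto.eventually hQ, h.mem] with s h1 h2 using h1 h2

/-- A smooth field that is tangent to `Λ` is related to a smooth field of the parameter space. -/
theorem exists_isRelated {V : X → X} (hV : SmoothNear V p₀)
    (hVΛ : ∀ᶠ p in 𝓝 p₀, p ∈ Λ → V p ∈ tangentSub Λ p) :
    ∃ v : P → P, SmoothNear v 0 ∧ IsRelated ψ V v := by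
  refine ⟨fun s => fderiv ℝ ρ (ψ s) (V (ψ s)),
    (h.smooth_inv.fderiv.comp h.smooth h.map_zero).clm_apply (hV.comp h.smooth h.map_zero), ?_⟩
  filter_upwards [h.eventually_param hVΛ, h.mem_tangentSub_iff, h.fderiv_inv_fderiv]
    with s h1 h2 h3
  obtain ⟨w, hw⟩ := (h2 _).1 h1
  rw [← hw, h3]

/-- The push-forward of a smooth field, extended to a neighbourhood of `Λ`. -/
theorem exists_pushforward {v : P → P} (hv : SmoothNear v 0) :
    ∃ V : X → X, SmoothNear V p₀ ∧ IsRelated ψ V v ∧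
      ∀ᶠ p in 𝓝 p₀, p ∈ Λ → V p ∈ tangentSub Λ p := by
  refine ⟨fun p => fderiv ℝ ψ (ρ p) (v (ρ p)), (h.smooth.fderiv.comp h.smooth_inv
    h.inv_zero).clm_apply (hv.comp h.smooth_inv h.inv_zero), ?_, ?_⟩
  · filter_upwards [h.left_inv] with s hs
    rw [hs]
  · refine h.eventually_of_mem (Q := fun s p => fderiv ℝ ψ s (v s) ∈ tangentSub Λ p) ?_
    filter_upwards [h.mem_tangentSub_iff] with s hs
    exact (hs _).2 ⟨_, rfl⟩

/-- Differentiating `V ∘ ψ = Dψ·v` produces terms in `D²ψ`, which cancel in the bracket by symmetry.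
-/
theorem isRelated_lieBracket {V W : X → X} {v w : P → P} (hV : SmoothNear V p₀)
    (hW : SmoothNear W p₀) (hv : SmoothNear v 0) (hw : SmoothNear w 0)
    (hVv : IsRelated ψ V v) (hWw : IsRelated ψ W w) :
    IsRelated ψ (VectorField.lieBracket ℝ V W) (VectorField.lieBracket ℝ v w) := by
  have key : ∀ {V : X → X} {v : P → P}, SmoothNear V p₀ → SmoothNear v 0 → IsRelated ψ V v →
      ∀ᶠ s in 𝓝 0, ∀ x, fderiv ℝ V (ψ s) (fderiv ℝ ψ s x) =
        fderiv ℝ (fderiv ℝ ψ) s x (v s) + fderiv ℝ ψ s (fderiv ℝ v s x) := by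
    intro V v hV hv hVv
    filter_upwards [hVv.eventually_nhds, h.tendsto.eventually hV.eventually_diff,
      h.smooth.eventually_diff, h.smooth.fderiv.eventually_diff, hv.eventually_diff]
      with s h1 h2 h3 h4 h5 x
    have h6 : (fun s => V (ψ s)) =ᶠ[𝓝 s] fun s => fderiv ℝ ψ s (v s) := h1
    have h7 := h6.fderiv_eq (𝕜 := ℝ)
    rw [fderiv_fun_comp s h2 h3, fderiv_clm_apply h4 h5] at h7
    simpa [add_comm] using congrArg (fun A : P →L[ℝ] X => A x) h7
  filter_upwards [key hV hv hVv, key hW hw hWw, hVv, hWw, h.smooth.eventually]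
    with s h1 h2 h3 h4 h5
  have h6 := h5.isSymmSndFDerivAt minSmoothness_two_le_infty
  simp only [VectorField.lieBracket]
  rw [h3, h4, h1, h2, map_sub, h6.eq (v s) (w s)]
  abel

end IsLocalParam

theorem IsRelated.add {ψ : P → X} {V W : X → X} {v w : P → P} (hV : IsRelated ψ V v)
    (hW : IsRelated ψ W w) : IsRelated ψ (fun p => V p + W p) (fun s => v s + w s) := by
  filter_upwards [hV, hW] with s h1 h2
  rw [h1, h2, map_add]

theorem IsRelated.smul {ψ : P → X} {V : X → X} {v : P → P} (hV : IsRelated ψ V v) (f : X → ℝ) :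
    IsRelated ψ (fun p => f p • V p) (fun s => f (ψ s) • v s) := by
  filter_upwards [hV] with s h1
  rw [h1, map_smul]

theorem SmoothNear.lieBracket {V W : X → X} {p : X} (hV : SmoothNear V p) (hW : SmoothNear W p) :
    SmoothNear (VectorField.lieBracket ℝ V W) p :=
  (hW.fderiv.clm_apply hV).sub (hV.fderiv.clm_apply hW)

end LocalParametrization

/-! ### The parametrization of `Λ` by `(x, y')`. -/

noncomputable section GraphParametrization

variable {k : ℕ}

/-- The parametrization of `Λ` by `(x, y')`. -/
def graphParam (Φ : OpenPartialHomeomorph (Eucl (k + 1)) (Eucl k × ℝ))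
    (φ : (Eucl k × ℝ) × Eucl k → ℝ) (s : (Eucl k × ℝ) × Eucl k) : Eucl (k + 1) × Eucl (k + 1) :=
  (Φ.symm s.1, Φ.symm (s.2, s.1.2 - φ s))

/-- The coordinates `(x, y')` of a point. -/
def graphProj (Φ : OpenPartialHomeomorph (Eucl (k + 1)) (Eucl k × ℝ))
    (p : Eucl (k + 1) × Eucl (k + 1)) : (Eucl k × ℝ) × Eucl k :=
  (Φ p.1, (Φ p.2).1)

variable {Λ : Set (Eucl (k + 1) × Eucl (k + 1))} {x₀ : Eucl (k + 1)}
  {Φ : OpenPartialHomeomorph (Eucl (k + 1)) (Eucl k × ℝ)} {φ : (Eucl k × ℝ) × Eucl k → ℝ}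

namespace IsStraightening

variable (hΦ : IsStraightening Λ x₀ Φ)
include hΦ

theorem zero_mem_target : (0 : Eucl k × ℝ) ∈ Φ.target := by
  rw [← hΦ.origin]; exact Φ.map_source hΦ.mem_source

theorem symm_zero : Φ.symm 0 = x₀ := by
  rw [← hΦ.origin]; exact Φ.left_inv hΦ.mem_source

theorem smoothNear : SmoothNear Φ x₀ := hΦ.smooth.smoothNear Φ.open_source hΦ.mem_source

theorem smoothNear_symm : SmoothNear Φ.symm 0 :=
  hΦ.smooth_symm.smoothNear Φ.open_target hΦ.zero_mem_target

theorem tendsto : Tendsto Φ (𝓝 x₀) (𝓝 0) := by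
  simpa [hΦ.origin] using hΦ.smoothNear.continuousAt.tendsto

theorem tendsto_symm : Tendsto Φ.symm (𝓝 0) (𝓝 x₀) := by
  simpa [hΦ.symm_zero] using hΦ.smoothNear_symm.continuousAt.tendsto

theorem eventually_target : ∀ᶠ z in 𝓝 0, z ∈ Φ.target :=
  Φ.open_target.mem_nhds hΦ.zero_mem_target

theorem eventually_source : ∀ᶠ z in 𝓝 x₀, z ∈ Φ.source :=
  Φ.open_source.mem_nhds hΦ.mem_source

theorem fderiv_symm_eq_zero_iff {z w : Eucl k × ℝ} (hz : z ∈ Φ.target) :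
    fderiv ℝ Φ.symm z w = 0 ↔ w = 0 := by
  refine ⟨fun h => ?_, fun h => by rw [h, map_zero]⟩
  have h1 : (fun z => Φ (Φ.symm z)) =ᶠ[𝓝 z] fun z => z := by
    filter_upwards [Φ.open_target.mem_nhds hz] with t ht using Φ.right_inv ht
  have h2 := h1.fderiv_eq (𝕜 := ℝ)
  rw [fderiv_fun_comp z ((hΦ.smooth.contDiffAt (Φ.open_source.mem_nhds
    (Φ.map_target hz))).differentiableAt (by simp))
    ((hΦ.smooth_symm.contDiffAt (Φ.open_target.mem_nhds hz)).differentiableAt (by simp))] at h2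
  have h3 := congrArg (fun A : (Eucl k × ℝ) →L[ℝ] (Eucl k × ℝ) => A w) h2
  simpa [h] using h3.symm

end IsStraightening

namespace IsGraphFunction

variable (hφ : IsGraphFunction Λ x₀ Φ φ) (hΦ : IsStraightening Λ x₀ Φ)
  (hdiag : ∀ᶠ x in 𝓝 x₀, (x, x) ∈ Λ)
include hφ hΦ

/-- The point with coordinates `(y', 0)` lies on `M_{x₀}`, so the graph equation reads `0 = 0 + φ(0,
y')`. -/
theorem eventually_eq_zero_of_fst_eq_zero : ∀ᶠ s in 𝓝 0, s.1 = 0 → φ s = 0 := by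
  have h1 : Tendsto (fun s : (Eucl k × ℝ) × Eucl k => (s.2, (0 : ℝ))) (𝓝 0) (𝓝 0) := by
    have : Continuous (fun s : (Eucl k × ℝ) × Eucl k => (s.2, (0 : ℝ))) := by fun_prop
    exact this.tendsto 0
  have h2 := hΦ.tendsto_symm.comp h1
  filter_upwards [h1.eventually hΦ.eventually_target, h2.eventually hΦ.hyperplane,
    (tendsto_const_nhds.prodMk_nhds h2).eventually hφ.graph] with s h3 h4 h5 h6
  obtain ⟨s₁, s₂⟩ := s
  obtain rfl : s₁ = 0 := h6
  have h7 := h5.1 (h4.2 (by simp [Function.comp, Φ.right_inv h3]))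
  simp only [Function.comp, Φ.right_inv h3, hΦ.origin] at h7
  simpa using h7.symm

include hdiag

theorem apply_zero : φ 0 = 0 := by
  have h := hφ.graph.self_of_nhds.1 hdiag.self_of_nhds
  simp only [hΦ.origin] at h
  exact (left_eq_add.1 h)

theorem tendsto_snd :
    Tendsto (fun s : (Eucl k × ℝ) × Eucl k => (s.2, s.1.2 - φ s)) (𝓝 0) (𝓝 0) := by
  have h : ContinuousAt (fun s : (Eucl k × ℝ) × Eucl k => (s.2, s.1.2 - φ s)) 0 :=
    (SmoothNear.id.snd.prodMk (SmoothNear.id.fst.snd.sub hφ.smooth)).continuousAt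
  have h0 := h.tendsto
  simp only [hφ.apply_zero hΦ hdiag] at h0
  simp only [Prod.snd_zero, Prod.fst_zero, sub_zero] at h0
  exact h0

theorem isLocalParam : IsLocalParam Λ (x₀, x₀) (graphParam Φ φ) (graphProj Φ) := by
  have h0 := hφ.apply_zero hΦ hdiag
  have ht := hφ.tendsto_snd hΦ hdiag
  have ht1 : Tendsto (fun s : (Eucl k × ℝ) × Eucl k => s.1) (𝓝 0) (𝓝 0) := continuous_fst.tendsto 0
  have hz : graphParam Φ φ 0 = (x₀, x₀) := by
    simp only [graphParam, h0, Prod.snd_zero, Prod.fst_zero, sub_zero, hΦ.symm_zero]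
    exact congrArg (Prod.mk x₀) hΦ.symm_zero
  have hsm : SmoothNear (graphParam Φ φ) 0 := by
    refine (hΦ.smoothNear_symm.comp SmoothNear.id.fst rfl).prodMk
      (hΦ.smoothNear_symm.comp (SmoothNear.id.snd.prodMk (SmoothNear.id.fst.snd.sub hφ.smooth)) ?_)
    simp [h0]
  have hli : ∀ᶠ s in 𝓝 0, Φ (graphParam Φ φ s).1 = s.1 ∧
      Φ (graphParam Φ φ s).2 = (s.2, s.1.2 - φ s) := by
    filter_upwards [ht.eventually hΦ.eventually_target, ht1.eventually hΦ.eventually_target]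
      with s h1 h2
    exact ⟨Φ.right_inv h2, Φ.right_inv h1⟩
  refine ⟨hz, hsm, ?_, ?_, ?_, ?_⟩
  · exact (hΦ.smoothNear.comp SmoothNear.id.fst rfl).prodMk
      (hΦ.smoothNear.comp SmoothNear.id.snd rfl).fst
  · have h1 := hsm.continuousAt.tendsto
    rw [hz] at h1
    filter_upwards [h1.eventually hφ.graph, hli] with s h2 h3
    rw [h2, h3.1, h3.2]
    ring
  · filter_upwards [hli] with s h3
    simp [graphProj, h3.1, h3.2]
  · filter_upwards [hφ.graph, (continuous_fst.tendsto (x₀, x₀)).eventually hΦ.eventually_source,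
      (continuous_snd.tendsto (x₀, x₀)).eventually hΦ.eventually_source] with p h1 h2 h3 hp
    have h4 := h1.1 hp
    simp only [graphParam, graphProj]
    rw [Φ.left_inv h2, show (Φ p.1).2 - φ (Φ p.1, (Φ p.2).1) = (Φ p.2).2 by rw [h4]; ring,
      Prod.mk.eta, Φ.left_inv h3]

/-- On the diagonal the graph equation reads `x_n = x_n + φ(x, x')`. -/
theorem eventually_eq_zero_of_diag : ∀ᶠ s in 𝓝 0, s.1.1 = s.2 → φ s = 0 := by
  have h2 := hΦ.tendsto_symm.comp (continuous_fst.tendsto (0 : (Eucl k × ℝ) × Eucl k))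
  filter_upwards [(continuous_fst.tendsto (0 : (Eucl k × ℝ) × Eucl k)).eventually
    hΦ.eventually_target, h2.eventually hdiag,
    (h2.prodMk_nhds h2).eventually hφ.graph] with s h3 h4 h5 h6
  have h7 := h5.1 h4
  simp only [Function.comp, Φ.right_inv h3] at h7
  rw [h6] at h7
  exact left_eq_add.1 h7

/-- `φ` vanishes on `{x = 0}` and on `{x' = y'}`, and these two subspaces together span the
parameter space. -/
theorem fderiv_zero : fderiv ℝ φ 0 = 0 := by
  have h1 : ∀ y : Eucl k, fderiv ℝ φ 0 (0, y) = 0 := fun y =>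
    (eventually_fderiv_eq_zero_of_eqOn (K := LinearMap.ker (LinearMap.fst ℝ (Eucl k × ℝ) (Eucl k)))
      hφ.smooth (hφ.eventually_eq_zero_of_fst_eq_zero hΦ)
      (a := (0, y)) rfl).self_of_nhds (Submodule.zero_mem _)
  have h2 : ∀ (x : Eucl k) (t : ℝ), fderiv ℝ φ 0 ((x, t), x) = 0 := fun x t =>
    (eventually_fderiv_eq_zero_of_eqOn (K := LinearMap.eqLocus
      ((LinearMap.fst ℝ (Eucl k) ℝ).comp (LinearMap.fst ℝ (Eucl k × ℝ) (Eucl k)))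
      (LinearMap.snd ℝ (Eucl k × ℝ) (Eucl k)))
      hφ.smooth (hφ.eventually_eq_zero_of_diag hΦ hdiag)
      (a := ((x, t), x)) rfl).self_of_nhds (Submodule.zero_mem _)
  refine ContinuousLinearMap.ext fun ⟨⟨x, t⟩, y⟩ => ?_
  have h3 : (((x, t), y) : (Eucl k × ℝ) × Eucl k) = ((x, t), x) + (0, y - x) := by simp
  rw [h3, map_add, h1, h2]
  simp

theorem fderiv_graphParam : ∀ᶠ s in 𝓝 0, ∀ v, fderiv ℝ (graphParam Φ φ) s v =
    (fderiv ℝ Φ.symm s.1 v.1,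
      fderiv ℝ Φ.symm (s.2, s.1.2 - φ s) (v.2, v.1.2 - fderiv ℝ φ s v)) := by
  have ht := hφ.tendsto_snd hΦ hdiag
  have ht1 : Tendsto (fun s : (Eucl k × ℝ) × Eucl k => s.1) (𝓝 0) (𝓝 0) := continuous_fst.tendsto 0
  filter_upwards [ht.eventually hΦ.smoothNear_symm.eventually_diff,
    ht1.eventually hΦ.smoothNear_symm.eventually_diff, hφ.smooth.eventually_diff] with s h1 h2 h3 v
  have h4 : HasFDerivAt (fun s : (Eucl k × ℝ) × Eucl k => (s.2, s.1.2 - φ s))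
      ((ContinuousLinearMap.snd ℝ _ _).prod (((ContinuousLinearMap.snd ℝ _ _).comp
        (ContinuousLinearMap.fst ℝ _ _)) - fderiv ℝ φ s)) s :=
    hasFDerivAt_snd.prodMk ((hasFDerivAt_snd.comp s hasFDerivAt_fst).sub h3.hasFDerivAt)
  have h5 : HasFDerivAt (graphParam Φ φ) _ s :=
    (h2.hasFDerivAt.comp s hasFDerivAt_fst).prodMk (h1.hasFDerivAt.comp s h4)
  rw [h5.fderiv]
  simp

/-- The second point has coordinates `(y', x_n - φ)`, so it is stationary along `v` exactly when the
`y'` component of `v` is zero and `v_n = Dφ(v)`. -/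
theorem fieldsV1_iff {V : Eucl (k + 1) × Eucl (k + 1) → Eucl (k + 1) × Eucl (k + 1)}
    {v : (Eucl k × ℝ) × Eucl k → (Eucl k × ℝ) × Eucl k} (hVv : IsRelated (graphParam Φ φ) V v) :
    (∀ᶠ p in 𝓝 (x₀, x₀), p ∈ Λ → (V p).2 = 0) ↔
      ∀ᶠ s in 𝓝 0, (v s).2 = 0 ∧ (v s).1.2 = fderiv ℝ φ s (v s) := by
  have hl := hφ.isLocalParam hΦ hdiag
  have key : ∀ᶠ s in 𝓝 0, (V (graphParam Φ φ s)).2 = 0 ↔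
      (v s).2 = 0 ∧ (v s).1.2 = fderiv ℝ φ s (v s) := by
    filter_upwards [hVv, hφ.fderiv_graphParam hΦ hdiag,
      (hφ.tendsto_snd hΦ hdiag).eventually hΦ.eventually_target] with s h1 h2 h3
    rw [h1, h2]
    rw [hΦ.fderiv_symm_eq_zero_iff h3, Prod.mk_eq_zero, sub_eq_zero]
  constructor
  · intro h
    filter_upwards [key, hl.eventually_param h] with s h1 h2 using h1.1 h2
  · intro h
    refine hl.eventually_of_mem (Q := fun _ p => (V p).2 = 0) ?_
    filter_upwards [key, h] with s h1 h2 using h1.2 h2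

theorem fieldsV2_iff {V : Eucl (k + 1) × Eucl (k + 1) → Eucl (k + 1) × Eucl (k + 1)}
    {v : (Eucl k × ℝ) × Eucl k → (Eucl k × ℝ) × Eucl k} (hVv : IsRelated (graphParam Φ φ) V v) :
    (∀ᶠ p in 𝓝 (x₀, x₀), p ∈ Λ → (V p).1 = 0) ↔ ∀ᶠ s in 𝓝 0, (v s).1 = 0 := by
  have hl := hφ.isLocalParam hΦ hdiag
  have key : ∀ᶠ s in 𝓝 0, (V (graphParam Φ φ s)).1 = 0 ↔ (v s).1 = 0 := by
    filter_upwards [hVv, hφ.fderiv_graphParam hΦ hdiag,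
      (continuous_fst.tendsto (0 : (Eucl k × ℝ) × Eucl k)).eventually hΦ.eventually_target]
      with s h1 h2 h3
    rw [h1, h2]
    rw [hΦ.fderiv_symm_eq_zero_iff h3]
  constructor
  · intro h
    filter_upwards [key, hl.eventually_param h] with s h1 h2 using h1.1 h2
  · intro h
    refine hl.eventually_of_mem (Q := fun _ p => (V p).1 = 0) ?_
    filter_upwards [key, h] with s h1 h2 using h1.2 h2

end IsGraphFunction

end GraphParametrization

/-! ### The curvature condition is the failure of flatness of `φ`. -/

noncomputable section Curvature

variable {k : ℕ} {Λ : Set (Eucl (k + 1) × Eucl (k + 1))} {x₀ : Eucl (k + 1)}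
  {Φ : OpenPartialHomeomorph (Eucl (k + 1)) (Eucl k × ℝ)} {φ : (Eucl k × ℝ) × Eucl k → ℝ}

/-- The coordinate vector of `x_n`. -/
def normalDir (k : ℕ) : (Eucl k × ℝ) × Eucl k := ((0, 1), 0)

/-- The component in the hyperplane `x_n = 0`. -/
def horizontalPart (k : ℕ) : ((Eucl k × ℝ) × Eucl k) →L[ℝ] (Eucl k × ℝ) × Eucl k :=
  ContinuousLinearMap.id ℝ _ - (((ContinuousLinearMap.snd ℝ _ _).comp
    (ContinuousLinearMap.fst ℝ _ _)).smulRight (normalDir k))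

theorem horizontalPart_apply (v : (Eucl k × ℝ) × Eucl k) :
    horizontalPart k v = v - v.1.2 • normalDir k := rfl

theorem horizontalPart_mem (v : (Eucl k × ℝ) × Eucl k) : horizontalPart k v ∈ horizontal k := by
  simp [horizontalPart_apply, normalDir]

theorem map_eq_horizontalPart_add {F : Type*} [NormedAddCommGroup F] [NormedSpace ℝ F]
    (A : ((Eucl k × ℝ) × Eucl k) →L[ℝ] F) (v : (Eucl k × ℝ) × Eucl k) :
    A v = A (horizontalPart k v) + v.1.2 • A (normalDir k) := by
  rw [horizontalPart_apply, map_sub, map_smul, sub_add_cancel]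

theorem isClosed_horizontal : IsClosed (horizontal k : Set ((Eucl k × ℝ) × Eucl k)) :=
  Submodule.closed_of_finiteDimensional _

theorem fderiv_normal_component {v : (Eucl k × ℝ) × Eucl k → (Eucl k × ℝ) × Eucl k}
    {s : (Eucl k × ℝ) × Eucl k} (hv : DifferentiableAt ℝ v s) (x : (Eucl k × ℝ) × Eucl k) :
    fderiv ℝ (fun s => (v s).1.2) s x = (fderiv ℝ v s x).1.2 := by
  have h : HasFDerivAt (fun s => (v s).1.2) ((ContinuousLinearMap.snd ℝ (Eucl k) ℝ).comp
      ((ContinuousLinearMap.fst ℝ (Eucl k × ℝ) (Eucl k)).comp (fderiv ℝ v s))) s :=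
    hasFDerivAt_snd.comp s (hasFDerivAt_fst.comp s hv.hasFDerivAt)
  rw [h.fderiv]; rfl

/-- The coefficient `a_x` of the field `∂_x + a_x ∂_n` of `𝒱₁`. -/
def normalSlope (φ : (Eucl k × ℝ) × Eucl k → ℝ) (x : Eucl k) (s : (Eucl k × ℝ) × Eucl k) : ℝ :=
  (1 - fderiv ℝ φ s (normalDir k))⁻¹ * fderiv ℝ φ s ((x, 0), 0)

/-- Every field of `𝔊(Λ)` is smooth and related to a smooth field of the parameter space; any
property `Q` of the latter that is compatible with the operations holds. -/
theorem LieAlgG.exists_isRelated (hφ : IsGraphFunction Λ x₀ Φ φ) (hΦ : IsStraightening Λ x₀ Φ)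
    (hdiag : ∀ᶠ x in 𝓝 x₀, (x, x) ∈ Λ)
    {Q : ((Eucl k × ℝ) × Eucl k → (Eucl k × ℝ) × Eucl k) → Prop}
    (h₁ : ∀ v, SmoothNear v 0 →
      (∀ᶠ s in 𝓝 0, (v s).2 = 0 ∧ (v s).1.2 = fderiv ℝ φ s (v s)) → Q v)
    (h₂ : ∀ v, SmoothNear v 0 → (∀ᶠ s in 𝓝 0, (v s).1 = 0) → Q v)
    (hadd : ∀ v w, SmoothNear v 0 → SmoothNear w 0 → Q v → Q w → Q fun s => v s + w s)
    (hsmul : ∀ (f : (Eucl k × ℝ) × Eucl k → ℝ) (v), SmoothNear f 0 → SmoothNear v 0 → Q v →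
      Q fun s => f s • v s)
    (hlie : ∀ v w, SmoothNear v 0 → SmoothNear w 0 → Q v → Q w →
      Q (VectorField.lieBracket ℝ v w))
    {V : Eucl (k + 1) × Eucl (k + 1) → Eucl (k + 1) × Eucl (k + 1)} (hV : LieAlgG Λ x₀ V) :
    SmoothNear V (x₀, x₀) ∧ ∃ v, SmoothNear v 0 ∧ IsRelated (graphParam Φ φ) V v ∧ Q v := by
  have hl := hφ.isLocalParam hΦ hdiag
  induction hV with
  | of_V1 hV =>
    obtain ⟨v, hv, hr⟩ := hl.exists_isRelated hV.1 (hV.2.mono fun p h hp => (h hp).1)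
    exact ⟨hV.1, v, hv, hr, h₁ v hv ((hφ.fieldsV1_iff hΦ hdiag hr).1
      (hV.2.mono fun p h hp => (h hp).2))⟩
  | of_V2 hV =>
    obtain ⟨v, hv, hr⟩ := hl.exists_isRelated hV.1 (hV.2.mono fun p h hp => (h hp).1)
    exact ⟨hV.1, v, hv, hr, h₂ v hv ((hφ.fieldsV2_iff hΦ hdiag hr).1
      (hV.2.mono fun p h hp => (h hp).2))⟩
  | add _ _ ihV ihW =>
    obtain ⟨hV, v, hv, hVv, hQv⟩ := ihV
    obtain ⟨hW, w, hw, hWw, hQw⟩ := ihW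
    exact ⟨hV.add hW, _, hv.add hw, hVv.add hWw, hadd v w hv hw hQv hQw⟩
  | smul hf _ ihV =>
    obtain ⟨hV, v, hv, hVv, hQv⟩ := ihV
    have hf' := hf.comp hl.smooth hl.map_zero
    exact ⟨hf.smul hV, _, hf'.smul hv, hVv.smul _, hsmul _ v hf' hv hQv⟩
  | bracket _ _ ihV ihW =>
    obtain ⟨hV, v, hv, hVv, hQv⟩ := ihV
    obtain ⟨hW, w, hw, hWw, hQw⟩ := ihW
    exact ⟨hV.lieBracket hW, _, hv.lieBracket hw, hl.isRelated_lieBracket hV hW hv hw hVv hWw,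
      hlie v w hv hw hQv hQw⟩

variable (hφ : IsGraphFunction Λ x₀ Φ φ) (hΦ : IsStraightening Λ x₀ Φ)
  (hdiag : ∀ᶠ x in 𝓝 x₀, (x, x) ∈ Λ)
include hφ hΦ hdiag

/-- Fields whose `∂_n` component is flat along the hyperplane form a module closed under brackets
that contains `𝒱₁` and `𝒱₂`; at the origin they take only horizontal values. -/
theorem not_curvatureLambda_of_vanishesAlong (h : ∀ m, VanishesAlong (horizontal k) m φ) :
    ¬ CurvatureLambda Λ x₀ := by
  have hl := hφ.isLocalParam hΦ hdiag
  have hD0 := hφ.fderiv_zero hΦ hdiag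
  have hG : ∀ V, LieAlgG Λ x₀ V → SmoothNear V (x₀, x₀) ∧ ∃ v, SmoothNear v 0 ∧
      IsRelated (graphParam Φ φ) V v ∧
      ∀ m, VanishesAlong (horizontal k) m (fun s => (v s).1.2) := by
    intro V hV
    refine hV.exists_isRelated hφ hΦ hdiag ?_ ?_ ?_ ?_ ?_
    · intro v hv hv1 m
      have hc : SmoothNear (fun s => 1 - fderiv ℝ φ s (normalDir k)) 0 :=
        (SmoothNear.const 1).sub (hφ.smooth.dirDeriv _)
      have hc0 : 1 - fderiv ℝ φ 0 (normalDir k) ≠ 0 := by simp [hD0]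
      have hsm : SmoothNear (fun s => horizontalPart k (v s)) 0 := hv.clm _
      -- Solving `v_n = Dφ(v)` for the normal component gives `v_n = (1 - ∂_n φ)⁻¹ Dφ(v_h)`, where
      -- `v_h` is the horizontal part.
      refine (((h (m + 1)).fderiv_apply hφ.smooth hsm
        (Eventually.of_forall fun s => horizontalPart_mem _) isClosed_horizontal).mul
        (hφ.smooth.fderiv.clm_apply hsm) (hc.inv hc0)).congr ?_
      filter_upwards [hv1, hc.continuousAt.eventually_ne hc0] with s h1 h2
      have h3 := h1.2
      rw [map_eq_horizontalPart_add, smul_eq_mul] at h3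
      rw [inv_mul_eq_iff_eq_mul₀ h2]
      linarith
    · intro v hv hv1 m
      refine (VanishesAlong.zero m).congr ?_
      filter_upwards [hv1] with s hs
      rw [hs]; rfl
    · intro v w hv hw hQv hQw m
      exact (hQv m).add (hQw m) hv.fst.snd hw.fst.snd
    · intro f v hf hv hQv m
      exact (hQv m).mul hv.fst.snd hf
    · intro v w hv hw hQv hQw m
      -- The normal component of `Dw·v` is the derivative of `w_n` along `v`: its horizontal part
      -- costs one order, which is harmless as all orders are available, and the rest carries the
      -- flat factor `v_n`.
      have key : ∀ {v w : (Eucl k × ℝ) × Eucl k → (Eucl k × ℝ) × Eucl k}, SmoothNear v 0 →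
          SmoothNear w 0 → (∀ m, VanishesAlong (horizontal k) m (fun s => (v s).1.2)) →
          (∀ m, VanishesAlong (horizontal k) m (fun s => (w s).1.2)) →
          VanishesAlong (horizontal k) m (fun s => (fderiv ℝ w s (v s)).1.2) := by
        intro v w hv hw hQv hQw
        have hsm : SmoothNear (fun s => horizontalPart k (v s)) 0 := hv.clm _
        refine (((hQw (m + 1)).fderiv_apply hw.fst.snd hsm
          (Eventually.of_forall fun s => horizontalPart_mem _) isClosed_horizontal).add
          ((hQv m).mul hv.fst.snd (hw.fst.snd.dirDeriv (normalDir k)))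
          (hw.fst.snd.fderiv.clm_apply hsm)
          ((hw.fst.snd.dirDeriv (normalDir k)).mul hv.fst.snd)).congr ?_
        filter_upwards [hw.eventually_diff] with s hs
        rw [← fderiv_normal_component hs, map_eq_horizontalPart_add (fderiv ℝ (fun s => (w s).1.2) s) (v s),
          smul_eq_mul, mul_comm (v s).1.2]
      exact (key hv hw hQv hQw).sub (key hw hv hQw hQv) (hw.fderiv.clm_apply hv).fst.snd
        (hv.fderiv.clm_apply hw).fst.snd
  intro hC
  have hT := hl.mem_tangentSub_iff.self_of_nhds
  have hi := hl.fderiv_inv_fderiv.self_of_nhds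
  rw [hl.map_zero] at hT hi
  have h1 : fderiv ℝ (graphParam Φ φ) 0 (normalDir k) ∈ tangentSub Λ (x₀, x₀) :=
    (hT _).2 ⟨_, rfl⟩
  rw [← hC] at h1
  have h2 : Submodule.span ℝ {v | ∃ V, LieAlgG Λ x₀ V ∧ V (x₀, x₀) = v} ≤
      (horizontal k).map (fderiv ℝ (graphParam Φ φ) 0).toLinearMap := by
    refine Submodule.span_le.2 ?_
    rintro _ ⟨V, hV, rfl⟩
    obtain ⟨-, v, hv, hVv, hQ⟩ := hG V hV
    have h3 := hVv.self_of_nhds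
    rw [hl.map_zero] at h3
    exact ⟨v 0, (hQ 1).1, h3.symm⟩
  obtain ⟨w, hw, hw'⟩ := h2 h1
  have h4 : w = normalDir k := by
    rw [← hi w, ← hi (normalDir k)]
    exact congrArg _ hw'
  rw [h4] at hw
  simp [normalDir] at hw

theorem normalSlope_zero (x : Eucl k) : normalSlope φ x 0 = 0 := by
  simp [normalSlope, hφ.fderiv_zero hΦ hdiag]

theorem eventually_one_sub_ne : ∀ᶠ s in 𝓝 0, 1 - fderiv ℝ φ s (normalDir k) ≠ 0 := by
  refine ((SmoothNear.const 1).sub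
    (hφ.smooth.dirDeriv (normalDir k))).continuousAt.eventually_ne ?_
  simp [hφ.fderiv_zero hΦ hdiag]

theorem smoothNear_normalSlope (x : Eucl k) : SmoothNear (normalSlope φ x) 0 :=
  (((SmoothNear.const 1).sub (hφ.smooth.dirDeriv (normalDir k))).inv
    (eventually_one_sub_ne hφ hΦ hdiag).self_of_nhds).mul (hφ.smooth.dirDeriv _)

theorem exists_lieAlgG_base (x : Eucl k) : ∃ V, LieAlgG Λ x₀ V ∧ SmoothNear V (x₀, x₀) ∧
    IsRelated (graphParam Φ φ) V fun s => ((x, normalSlope φ x s), 0) := by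
  have hl := hφ.isLocalParam hΦ hdiag
  have hs : SmoothNear (fun s => (((x, normalSlope φ x s), 0) : (Eucl k × ℝ) × Eucl k)) 0 :=
    ((SmoothNear.const x).prodMk (smoothNear_normalSlope hφ hΦ hdiag x)).prodMk (SmoothNear.const 0)
  obtain ⟨V, hV, hr, hT⟩ := hl.exists_pushforward hs
  refine ⟨V, .of_V1 ⟨hV, ?_⟩, hV, hr⟩
  have h1 := (hφ.fieldsV1_iff hΦ hdiag hr).2 (by
    filter_upwards [eventually_one_sub_ne hφ hΦ hdiag] with s hs
    refine ⟨rfl, ?_⟩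
    rw [map_eq_horizontalPart_add]
    have h2 : horizontalPart k ((x, normalSlope φ x s), 0) = ((x, 0), 0) := by
      simp [horizontalPart_apply, normalDir]
    rw [h2, smul_eq_mul]
    simp only [normalSlope]
    field_simp
    ring)
  filter_upwards [hT, h1] with p h2 h3 hp using ⟨h2 hp, h3 hp⟩

theorem exists_lieAlgG_fibre (y : Eucl k) : ∃ V, LieAlgG Λ x₀ V ∧ SmoothNear V (x₀, x₀) ∧
    IsRelated (graphParam Φ φ) V fun _ => (0, y) := by
  have hl := hφ.isLocalParam hΦ hdiag
  obtain ⟨V, hV, hr, hT⟩ := hl.exists_pushforward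
    (SmoothNear.const ((0, y) : (Eucl k × ℝ) × Eucl k))
  refine ⟨V, .of_V2 ⟨hV, ?_⟩, hV, hr⟩
  have h1 := (hφ.fieldsV2_iff hΦ hdiag hr).2 (Eventually.of_forall fun s => rfl)
  filter_upwards [hT, h1] with p h2 h3 hp using ⟨h2 hp, h3 hp⟩

/-- The slopes `a_x` vanish at the origin, so the fields of `𝒱₁` and `𝒱₂` already give all
horizontal directions there; one vector with nonzero normal component completes the span. -/
theorem curvatureLambda_of_normal_ne {V : Eucl (k + 1) × Eucl (k + 1) → Eucl (k + 1) × Eucl (k + 1)}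
    {v : (Eucl k × ℝ) × Eucl k → (Eucl k × ℝ) × Eucl k} (hV : LieAlgG Λ x₀ V)
    (hVv : IsRelated (graphParam Φ φ) V v) (hne : (v 0).1.2 ≠ 0) : CurvatureLambda Λ x₀ := by
  have hl := hφ.isLocalParam hΦ hdiag
  have hT := hl.mem_tangentSub_iff.self_of_nhds
  rw [hl.map_zero] at hT
  have hval : ∀ {V v}, IsRelated (graphParam Φ φ) V v →
      V (x₀, x₀) = fderiv ℝ (graphParam Φ φ) 0 (v 0) := fun h => by
    have := h.self_of_nhds
    rwa [hl.map_zero] at this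
  set S := Submodule.span ℝ {v | ∃ V, LieAlgG Λ x₀ V ∧ V (x₀, x₀) = v} with hS
  have hmem : ∀ {V v}, LieAlgG Λ x₀ V → IsRelated (graphParam Φ φ) V v →
      fderiv ℝ (graphParam Φ φ) 0 (v 0) ∈ S := fun h h' =>
    Submodule.subset_span ⟨_, h, hval h'⟩
  refine le_antisymm (Submodule.span_le.2 ?_) ?_
  · rintro _ ⟨V, hV, rfl⟩
    obtain ⟨-, v, -, hr, -⟩ := hV.exists_isRelated hφ hΦ hdiag (Q := fun _ => True)
      (fun _ _ _ => trivial) (fun _ _ _ => trivial) (fun _ _ _ _ _ _ => trivial)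
      (fun _ _ _ _ _ => trivial) (fun _ _ _ _ _ _ => trivial)
    exact (hT _).2 ⟨v 0, (hval hr).symm⟩
  · intro z hz
    obtain ⟨⟨⟨x, t⟩, y⟩, rfl⟩ := (hT _).1 hz
    set c := t / (v 0).1.2 with hc
    obtain ⟨V₁, hV₁, -, hr₁⟩ := exists_lieAlgG_base hφ hΦ hdiag (x - c • (v 0).1.1)
    obtain ⟨V₂, hV₂, -, hr₂⟩ := exists_lieAlgG_fibre hφ hΦ hdiag (y - c • (v 0).2)
    have h1 := hmem hV₁ hr₁
    simp only [normalSlope_zero hφ hΦ hdiag] at h1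
    have h2 := S.add_mem (S.add_mem (S.smul_mem c (hmem hV hVv)) h1) (hmem hV₂ hr₂)
    rw [← map_smul, ← map_add, ← map_add] at h2
    convert h2 using 2
    have h3 : c * (v 0).1.2 = t := div_mul_cancel₀ _ hne
    refine Prod.ext (Prod.ext ?_ ?_) ?_
    · simp
    · simp [h3]
    · simp

/-- Each round gains one order for `φ`: from `φ` to `a_x`, then to `∂_y a_x` through the Lie
algebra, then to `∂_y ∂_x φ`, and back to `φ` by two integrations. -/
theorem vanishesAlong_of_not_curvatureLambda (hC : ¬ CurvatureLambda Λ x₀) (m : ℕ) :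
    VanishesAlong (horizontal k) m φ := by
  have hl := hφ.isLocalParam hΦ hdiag
  have hD := eventually_one_sub_ne hφ hΦ hdiag
  have ha := smoothNear_normalSlope hφ hΦ hdiag
  -- The coefficients `f` for which `𝔊(Λ)` contains a field related to `f ∂_n`.
  let G : ((Eucl k × ℝ) × Eucl k → ℝ) → Prop := fun f => SmoothNear f 0 ∧ ∃ V, LieAlgG Λ x₀ V ∧
    SmoothNear V (x₀, x₀) ∧ IsRelated (graphParam Φ φ) V fun s => ((0, f s), 0)
  have hG0 : ∀ f, G f → f 0 = 0 := fun f hf => by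
    obtain ⟨-, V, hV, -, hr⟩ := hf
    by_contra hne
    exact hC (curvatureLambda_of_normal_ne hφ hΦ hdiag hV hr hne)
  have hsm : ∀ {f : (Eucl k × ℝ) × Eucl k → ℝ}, SmoothNear f 0 →
      SmoothNear (fun s => (((0, f s), 0) : (Eucl k × ℝ) × Eucl k)) 0 := fun hf =>
    ((SmoothNear.const 0).prodMk hf).prodMk (SmoothNear.const 0)
  have hDf : ∀ {f : (Eucl k × ℝ) × Eucl k → ℝ} (x : Eucl k) {s}, DifferentiableAt ℝ f s → ∀ v,
      fderiv ℝ (fun s => (((x, f s), 0) : (Eucl k × ℝ) × Eucl k)) s v =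
        ((0, fderiv ℝ f s v), 0) := fun x s hf v => by
    have h1 := ((hasFDerivAt_const x s).prodMk hf.hasFDerivAt).prodMk
      (hasFDerivAt_const (0 : Eucl k) s)
    rw [h1.fderiv]; rfl
  have hGy : ∀ f, G f → ∀ y : Eucl k, G (fun s => fderiv ℝ f s (0, y)) := by
    rintro f ⟨hf, V, hV, hVs, hr⟩ y
    obtain ⟨W, hW, hWs, hWr⟩ := exists_lieAlgG_fibre hφ hΦ hdiag y
    refine ⟨hf.dirDeriv _, _, hW.bracket hV, hWs.lieBracket hVs, ?_⟩
    filter_upwards [hl.isRelated_lieBracket hWs hVs (SmoothNear.const _) (hsm hf) hWr hr,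
      hf.eventually_diff] with s h1 h2
    rw [h1, VectorField.lieBracket, hDf _ h2]
    simp
  have hGa : ∀ x y : Eucl k, G (fun s => fderiv ℝ (normalSlope φ x) s (0, y)) := by
    intro x y
    obtain ⟨V, hV, hVs, hr⟩ := exists_lieAlgG_base hφ hΦ hdiag x
    obtain ⟨W, hW, hWs, hWr⟩ := exists_lieAlgG_fibre hφ hΦ hdiag y
    refine ⟨(ha x).dirDeriv _, _, hW.bracket hV, hWs.lieBracket hVs, ?_⟩
    filter_upwards [hl.isRelated_lieBracket hWs hVs (SmoothNear.const _)
      (((SmoothNear.const x).prodMk (ha x)).prodMk (SmoothNear.const 0)) hWr hr,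
      (ha x).eventually_diff] with s h1 h2
    rw [h1, VectorField.lieBracket, hDf _ h2]
    simp
  have hGx : ∀ f, G f → ∀ x : Eucl k, G (fun s => fderiv ℝ f s ((x, normalSlope φ x s), 0) -
      f s * fderiv ℝ (normalSlope φ x) s (normalDir k)) := by
    rintro f ⟨hf, V, hV, hVs, hr⟩ x
    obtain ⟨W, hW, hWs, hWr⟩ := exists_lieAlgG_base hφ hΦ hdiag x
    have hx : SmoothNear (fun s => (((x, normalSlope φ x s), 0) : (Eucl k × ℝ) × Eucl k)) 0 :=
      ((SmoothNear.const x).prodMk (ha x)).prodMk (SmoothNear.const 0)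
    refine ⟨(hf.fderiv.clm_apply hx).sub (hf.mul ((ha x).dirDeriv _)), _, hW.bracket hV,
      hWs.lieBracket hVs, ?_⟩
    filter_upwards [hl.isRelated_lieBracket hWs hVs hx (hsm hf) hWr hr,
      hf.eventually_diff, (ha x).eventually_diff] with s h1 h2 h3
    have h4 : (((0, f s), 0) : (Eucl k × ℝ) × Eucl k) = f s • normalDir k := by
      simp [normalDir]
    rw [h1, VectorField.lieBracket, hDf _ h2, hDf _ h3, h4, map_smul, smul_eq_mul]
    simp
  -- For a horizontal direction `(x, y)` the derivative of `f` is `(X_x f - f ∂_n a_x) + ∂_y f + f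
  -- ∂_n a_x - a_x ∂_n f`. The first two terms are again in `G`, the third contains `f`, and the
  -- last contains `a_x`, which vanishes to order `l`; hence induction on `j` up to `l + 1`.
  have hGv : ∀ l, (∀ x, VanishesAlong (horizontal k) l (normalSlope φ x)) → ∀ j ≤ l + 1, ∀ f, G f →
      VanishesAlong (horizontal k) j f := by
    intro l hl j
    induction j with
    | zero => intros; trivial
    | succ j ih =>
      intro hj f hf
      refine ⟨hG0 f hf, ?_⟩
      rintro ⟨⟨x, t⟩, y⟩ ht
      obtain rfl : t = 0 := ht
      have ih' := ih (by omega)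
      have hf1 := hGx f hf x
      have hf2 := hGy f hf y
      have hs1 := hf.1.mul ((ha x).dirDeriv (normalDir k))
      have hs2 := (hf.1.dirDeriv (normalDir k)).mul (ha x)
      refine ((((ih' _ hf1).add (ih' _ hf2) hf1.1 hf2.1).add ((ih' f hf).mul hf.1
        ((ha x).dirDeriv (normalDir k))) (hf1.1.add hf2.1)
        (((ha x).dirDeriv (normalDir k)).mul hf.1)).sub
        (((hl x).mono (by omega)).mul (ha x) (hf.1.dirDeriv (normalDir k)))
        ((hf1.1.add hf2.1).add (((ha x).dirDeriv (normalDir k)).mul hf.1)) hs2).congr ?_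
      refine Eventually.of_forall fun s => ?_
      have h1 : (((x, normalSlope φ x s), 0) : (Eucl k × ℝ) × Eucl k) =
          ((x, 0), 0) + normalSlope φ x s • normalDir k := by simp [normalDir]
      have h2 : (((x, 0), y) : (Eucl k × ℝ) × Eucl k) = ((x, 0), 0) + (0, y) := by simp
      simp only
      rw [h1, h2, map_add, map_add, map_smul, smul_eq_mul]
      ring
  induction m with
  | zero => trivial
  | succ m ih =>
    -- Order one is only `φ(0) = 0`. Afterwards `φ` is known to order `l + 1`, hence `a_x` to order
    -- `l`, and the goal is order `l + 2`.
    obtain _ | l := m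
    · exact ⟨hφ.apply_zero hΦ hdiag, fun _ _ => trivial⟩
    have hvs : ∀ x, VanishesAlong (horizontal k) l (normalSlope φ x) := fun x =>
      (ih.2 ((x, 0), 0) rfl).mul (hφ.smooth.dirDeriv _) (((SmoothNear.const 1).sub
        (hφ.smooth.dirDeriv (normalDir k))).inv hD.self_of_nhds)
    have hc : SmoothNear (fun s => 1 - fderiv ℝ φ s (normalDir k)) 0 :=
      (SmoothNear.const 1).sub (hφ.smooth.dirDeriv _)
    -- Differentiate `∂_x φ = (1 - ∂_n φ) a_x` in the direction `y`.
    have hxy : ∀ x y, VanishesAlong (horizontal k) l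
        (fun s => fderiv ℝ (fun s => fderiv ℝ φ s ((x, 0), 0)) s (0, y)) := by
      intro x y
      have h1 := (hGv l hvs l (by omega) _ (hGa x y)).mul ((ha x).dirDeriv _) hc
      have h2 := (hvs x).mul (ha x) (hc.dirDeriv (0, y))
      refine (h1.add h2 (hc.mul ((ha x).dirDeriv _)) ((hc.dirDeriv _).mul (ha x))).congr ?_
      have h3 : (fun s => fderiv ℝ φ s ((x, 0), 0)) =ᶠ[𝓝 0]
          fun s => (1 - fderiv ℝ φ s (normalDir k)) * normalSlope φ x s := by
        filter_upwards [hD] with s hs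
        rw [normalSlope, mul_inv_cancel_left₀ hs]
      filter_upwards [h3.eventuallyEq_nhds, hc.eventually_diff, (ha x).eventually_diff]
        with s h4 h5 h6
      rw [h4.fderiv_eq, fderiv_fun_mul h5 h6]
      simp [mul_comm]
    -- First integration: `∂_y φ` vanishes on `{x = 0}`, and its `x'` derivatives are controlled by
    -- `hxy`.
    have hy : ∀ y : Eucl k, VanishesAlong (horizontal k) (l + 1)
        (fun s => fderiv ℝ φ s (0, y)) := by
      intro y
      refine VanishesAlong.of_eqOn
        (K₁ := LinearMap.ker (LinearMap.fst ℝ (Eucl k × ℝ) (Eucl k)))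
        (K₂ := LinearMap.range ((LinearMap.inl ℝ (Eucl k × ℝ) (Eucl k)).comp
          (LinearMap.inl ℝ (Eucl k) ℝ))) ?_ ?_ (hφ.smooth.dirDeriv _) ?_ ?_
      · rintro ⟨⟨x, t⟩, y⟩ ht
        obtain rfl : t = 0 := ht
        exact Submodule.mem_sup.2 ⟨(0, y), rfl, ((x, 0), 0), ⟨x, rfl⟩, by simp⟩
      · rintro ⟨z, y⟩ hz
        obtain rfl : z = 0 := hz
        rfl
      · exact eventually_fderiv_eq_zero_of_eqOn hφ.smooth
          (hφ.eventually_eq_zero_of_fst_eq_zero hΦ) rfl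
      · rintro _ ⟨x, rfl⟩
        exact (hxy x y).congr (hφ.smooth.dirDeriv_comm _ _)
    -- Second integration: `φ` vanishes on `{x' = y', x_n = 0}`, and its `y'` derivatives are
    -- controlled by `hy`.
    refine VanishesAlong.of_eqOn
      (K₁ := LinearMap.range (((LinearMap.inl ℝ (Eucl k × ℝ) (Eucl k)).comp
          (LinearMap.inl ℝ (Eucl k) ℝ)) + LinearMap.inr ℝ (Eucl k × ℝ) (Eucl k)))
      (K₂ := LinearMap.range (LinearMap.inr ℝ (Eucl k × ℝ) (Eucl k))) ?_ ?_ hφ.smooth ?_ ?_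
    · rintro ⟨⟨x, t⟩, y⟩ ht
      obtain rfl : t = 0 := ht
      exact Submodule.mem_sup.2 ⟨((x, 0), x), ⟨x, by simp⟩, (0, y - x), ⟨y - x, rfl⟩, by simp⟩
    · rintro _ ⟨x, rfl⟩
      simp
    · filter_upwards [hφ.eventually_eq_zero_of_diag hΦ hdiag] with s hs
      rintro ⟨x, rfl⟩
      exact hs (by simp)
    · rintro _ ⟨y, rfl⟩
      exact hy y

theorem curvatureLambda_iff_not_vanishesAlong :
    CurvatureLambda Λ x₀ ↔ ¬ ∀ m, VanishesAlong (horizontal k) m φ :=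
  ⟨fun hC h => not_curvatureLambda_of_vanishesAlong hφ hΦ hdiag h hC, fun h => by
    by_contra hC
    exact h (vanishesAlong_of_not_curvatureLambda hφ hΦ hdiag hC)⟩

theorem curvatureLambda_iff_exists_mixedPartial :
    CurvatureLambda Λ x₀ ↔ ∃ α β : Fin k → ℕ, mixedPartial α β φ 0 ≠ 0 := by
  rw [curvatureLambda_iff_not_vanishesAlong hφ hΦ hdiag,
    forall_vanishesAlong_horizontal_iff hφ.smooth]
  push Not
  rfl

end Curvature

/-! ### Infinite-order tangency is flatness of `φ`. -/

section Tangency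

/-- A smooth function that vanishes on a set is bounded by a multiple of the distance to this
set. -/
theorem exists_eventually_norm_le_mul_infDist {X : Type*} [NormedAddCommGroup X] [NormedSpace ℝ X]
    {S : Set X} {g : X → ℝ} {p : X} (hp : p ∈ S) (hg : SmoothNear g p)
    (h0 : ∀ᶠ q in 𝓝 p, q ∈ S → g q = 0) :
    ∃ L : ℝ, ∀ᶠ q in 𝓝 p, ‖g q‖ ≤ L * Metric.infDist q S := by
  obtain ⟨L, U, hU, hL⟩ := (hg.contDiffAt.of_le (m := 1) (by simp)).exists_lipschitzOnWith
  obtain ⟨ε, hε, hball⟩ := Metric.eventually_nhds_iff.1 (h0.and hU)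
  refine ⟨L, Metric.eventually_nhds_iff.2 ⟨ε / 2, by positivity, fun q hq => ?_⟩⟩
  have h1 : Metric.infDist q S < ε / 2 := (Metric.infDist_le_dist_of_mem hp).trans_lt hq
  -- The distance to `S` need not be attained, so a point of `S` at distance less than `d` is used
  -- and `d` decreases to the infimum. The radius `ε / 2` keeps that point within `ε` of `p`.
  have hlim : Tendsto (fun d : ℝ => L * d) (𝓝[>] Metric.infDist q S)
      (𝓝 (L * Metric.infDist q S)) :=
    ((continuous_const.mul continuous_id).tendsto _).mono_left nhdsWithin_le_nhds
  refine ge_of_tendsto hlim ?_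
  filter_upwards [Ioo_mem_nhdsGT h1] with d hd
  obtain ⟨b, hb, hqb⟩ := (Metric.infDist_lt_iff ⟨p, hp⟩).1 hd.1
  have h2 : dist b p < ε := by
    have := dist_triangle_left b p q
    linarith [hd.2]
  have h3 := hL.norm_sub_le (hball (hq.trans (by linarith))).2 (hball h2).2
  rw [(hball h2).1 hb, sub_zero, ← dist_eq_norm] at h3
  exact h3.trans (mul_le_mul_of_nonneg_left hqb.le L.2)

variable {k : ℕ} {Λ : Set (Eucl (k + 1) × Eucl (k + 1))} {x₀ : Eucl (k + 1)}
  {Φ : OpenPartialHomeomorph (Eucl (k + 1)) (Eucl k × ℝ)} {φ : (Eucl k × ℝ) × Eucl k → ℝ}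

/-- At a point of `M_{x₀} × M_{x₀}` the defining function `x_n - y_n - φ` equals `-φ`, so `|φ|` is
at most a multiple of the distance to `Λ`. Conversely, moving `y_n` from `0` to `-φ` reaches `Λ`, so
the distance is `O(|φ|)`. -/
theorem tangentToInfiniteOrder_iff_vanishesAlong (hφ : IsGraphFunction Λ x₀ Φ φ)
    (hΦ : IsStraightening Λ x₀ Φ) (hdiag : ∀ᶠ x in 𝓝 x₀, (x, x) ∈ Λ) :
    TangentToInfiniteOrder (fiberM Λ x₀ ×ˢ fiberM Λ x₀) Λ (x₀, x₀) ↔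
      ∀ m, VanishesAlong (horizontal k) m φ := by
  have hl := hφ.isLocalParam hΦ hdiag
  have hp1 : Tendsto (fun q : Eucl (k + 1) × Eucl (k + 1) => q.1) (𝓝 (x₀, x₀)) (𝓝 x₀) :=
    continuous_fst.tendsto _
  have hp2 : Tendsto (fun q : Eucl (k + 1) × Eucl (k + 1) => q.2) (𝓝 (x₀, x₀)) (𝓝 x₀) :=
    continuous_snd.tendsto _
  rw [vanishesAlong_iff_isBigO_pow hφ.smooth]
  constructor
  · intro h N
    let g : Eucl (k + 1) × Eucl (k + 1) → ℝ := fun p => (Φ p.1).2 - (Φ p.2).2 - φ (graphProj Φ p)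
    have hg : SmoothNear g (x₀, x₀) :=
      ((hΦ.smoothNear.comp SmoothNear.id.fst rfl).snd.sub
        (hΦ.smoothNear.comp SmoothNear.id.snd rfl).snd).sub
          (hφ.smooth.comp hl.smooth_inv hl.inv_zero)
    have hg0 : ∀ᶠ p in 𝓝 (x₀, x₀), p ∈ Λ → g p = 0 := by
      filter_upwards [hφ.graph] with p h1 h2
      have := h1.1 h2
      simp only [g, graphProj]
      linarith
    obtain ⟨L, hL⟩ := exists_eventually_norm_le_mul_infDist hdiag.self_of_nhds hg hg0
    -- On the hyperplane `x_n = 0` this parametrizes `M_{x₀} × M_{x₀}`.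
    let σ : (Eucl k × ℝ) × Eucl k → Eucl (k + 1) × Eucl (k + 1) :=
      fun s => (Φ.symm s.1, Φ.symm (s.2, 0))
    have hσ : SmoothNear σ 0 := (hΦ.smoothNear_symm.comp SmoothNear.id.fst rfl).prodMk
      (hΦ.smoothNear_symm.comp (SmoothNear.id.snd.prodMk (SmoothNear.const 0)) rfl)
    have hσ0 : σ 0 = (x₀, x₀) := Prod.ext hΦ.symm_zero hΦ.symm_zero
    have hσt : Tendsto σ (𝓝 0) (𝓝 (x₀, x₀)) := by simpa [hσ0] using hσ.continuousAt.tendsto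
    have ht1 : Tendsto (fun s : (Eucl k × ℝ) × Eucl k => s.1) (𝓝 0) (𝓝 0) :=
      continuous_fst.tendsto 0
    have ht2 : Tendsto (fun s : (Eucl k × ℝ) × Eucl k => (s.2, (0 : ℝ))) (𝓝 0) (𝓝 0) := by
      have : Continuous (fun s : (Eucl k × ℝ) × Eucl k => (s.2, (0 : ℝ))) := by fun_prop
      exact this.tendsto 0
    have hinv : ∀ᶠ s in 𝓝 0, Φ (σ s).1 = s.1 ∧ Φ (σ s).2 = (s.2, 0) := by
      filter_upwards [ht1.eventually hΦ.eventually_target, ht2.eventually hΦ.eventually_target]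
        with s h1 h2 using ⟨Φ.right_inv h1, Φ.right_inv h2⟩
    have hσK : Tendsto σ (𝓝[horizontal k] 0) (𝓝[fiberM Λ x₀ ×ˢ fiberM Λ x₀] (x₀, x₀)) := by
      refine tendsto_nhdsWithin_iff.2 ⟨hσt.mono_left nhdsWithin_le_nhds, ?_⟩
      rw [eventually_nhdsWithin_iff]
      filter_upwards [hinv, (hp1.comp hσt).eventually hΦ.hyperplane,
        (hp2.comp hσt).eventually hΦ.hyperplane] with s h1 h2 h3 hs
      refine ⟨h2.2 ?_, h3.2 ?_⟩
      · exact (congrArg Prod.snd h1.1).trans hs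
      · exact congrArg Prod.snd h1.2
    have h1 := (h N).comp_tendsto hσK
    have h2 : (fun s => ‖σ s - (x₀, x₀)‖ ^ N) =O[𝓝[horizontal k] 0] fun s => ‖s‖ ^ N := by
      have h3 := hσ.differentiableAt.isBigO_sub
      simp only [hσ0, sub_zero] at h3
      exact (h3.norm_norm.pow N).mono nhdsWithin_le_nhds
    refine IsBigO.trans (IsBigO.of_bound L ?_) (h1.trans h2)
    rw [eventually_nhdsWithin_iff]
    filter_upwards [hinv, hσt.eventually hL] with s h3 h4 hs
    have h5 : g (σ s) = - φ s := by
      have h6 : graphProj Φ (σ s) = s := Prod.ext h3.1 (congrArg Prod.fst h3.2)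
      have h7 : s.1.2 = 0 := hs
      simp only [g, h6, h3.1, h3.2, h7]
      ring
    rw [h5, norm_neg] at h4
    simpa [abs_of_nonneg Metric.infDist_nonneg] using h4
  · intro h N
    set A := fiberM Λ x₀ ×ˢ fiberM Λ x₀ with hA
    have hAz : ∀ᶠ q in 𝓝[A] (x₀, x₀), (Φ q.1).2 = 0 ∧ (Φ q.2).2 = 0 := by
      rw [eventually_nhdsWithin_iff]
      filter_upwards [hp1.eventually hΦ.hyperplane, hp2.eventually hΦ.hyperplane] with q h1 h2 hq
        using ⟨h1.1 hq.1, h2.1 hq.2⟩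
    have hρ : Tendsto (graphProj Φ) (𝓝[A] (x₀, x₀)) (𝓝[horizontal k] 0) :=
      tendsto_nhdsWithin_iff.2 ⟨hl.tendsto_inv.mono_left nhdsWithin_le_nhds,
        hAz.mono fun q hq => hq.1⟩
    have h1 := (h N).comp_tendsto hρ
    have h2 : (fun q => ‖graphProj Φ q‖ ^ N) =O[𝓝[A] (x₀, x₀)] fun q => ‖q - (x₀, x₀)‖ ^ N := by
      have h3 := hl.smooth_inv.differentiableAt.isBigO_sub
      simp only [hl.inv_zero, sub_zero] at h3
      exact (h3.norm_norm.pow N).mono nhdsWithin_le_nhds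
    refine IsBigO.trans ?_ (h1.trans h2)
    -- The coordinates of the second component of the point of `Λ` with the same `(x, y')` as `q`.
    let b : Eucl (k + 1) × Eucl (k + 1) → Eucl k × ℝ :=
      fun q => ((graphProj Φ q).2, (graphProj Φ q).1.2 - φ (graphProj Φ q))
    have hb : Tendsto b (𝓝 (x₀, x₀)) (𝓝 0) :=
      (hφ.tendsto_snd hΦ hdiag).comp hl.tendsto_inv
    have h3 := ((hΦ.smoothNear_symm.contDiffAt.hasStrictFDerivAt (by simp)).isBigO_sub).comp_tendsto
      ((hΦ.tendsto.comp hp2).prodMk_nhds hb)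
    have h4 : (fun q => Metric.infDist q Λ) =O[𝓝[A] (x₀, x₀)]
        fun q => Φ.symm (Φ q.2) - Φ.symm (b q) := by
      refine IsBigO.of_bound 1 (nhdsWithin_le_nhds ?_)
      filter_upwards [hp1.eventually hΦ.eventually_source, hp2.eventually hΦ.eventually_source,
        hl.tendsto_inv.eventually hl.mem] with q h5 h6 h7
      rw [Real.norm_of_nonneg Metric.infDist_nonneg, one_mul]
      refine (Metric.infDist_le_dist_of_mem h7).trans ?_
      rw [Prod.dist_eq]
      refine max_le ?_ ?_
      · simp [graphParam, graphProj, Φ.left_inv h5]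
      · rw [Φ.left_inv h6, dist_eq_norm]; rfl
    refine (h4.trans (h3.mono nhdsWithin_le_nhds)).trans (IsBigO.of_bound 1 ?_)
    filter_upwards [hAz] with q hq
    have h5 : (Φ q.2 - b q) = (0, φ (graphProj Φ q)) := by
      refine Prod.ext ?_ ?_
      · simp [b, graphProj]
      · simp [b, graphProj, hq.1, hq.2]
    simp only [Function.comp, h5, one_mul]
    simp [Prod.norm_def]

end Tangency

/-! ### The smooth inverse function theorem. -/

section InverseFunction

/-- The inverse function theorem for `C^∞` maps between finite-dimensional spaces of the same
dimension. -/
theorem exists_openPartialHomeomorph_of_injective_fderiv {E F : Type*} [NormedAddCommGroup E]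
    [NormedSpace ℝ E] [FiniteDimensional ℝ E] [NormedAddCommGroup F] [NormedSpace ℝ F]
    [FiniteDimensional ℝ F] (hEF : Module.finrank ℝ E = Module.finrank ℝ F) {f : E → F} {a : E}
    (hf : SmoothNear f a) (hinj : Function.Injective (fderiv ℝ f a)) :
    ∃ Ψ : OpenPartialHomeomorph E F, a ∈ Ψ.source ∧ ContDiffOn ℝ ∞ Ψ Ψ.source ∧
      ContDiffOn ℝ ∞ Ψ.symm Ψ.target ∧ ∀ x, Ψ x = f x := by
  have : CompleteSpace E := FiniteDimensional.complete ℝ E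
  let A : E ≃L[ℝ] F := (LinearEquiv.ofInjectiveOfFinrankEq (fderiv ℝ f a).toLinearMap hinj
    hEF).toContinuousLinearEquiv
  have hA : (A : E →L[ℝ] F) = fderiv ℝ f a := by ext v; rfl
  have hs : HasStrictFDerivAt f (A : E →L[ℝ] F) a := by
    rw [hA]; exact hf.contDiffAt.hasStrictFDerivAt (by simp)
  have hev : ∀ᶠ x in 𝓝 a, ContDiffAt ℝ ∞ f x ∧
      fderiv ℝ f x ∈ range ((↑) : (E ≃L[ℝ] F) → E →L[ℝ] F) := by
    refine hf.eventually.and (hf.fderiv.continuousAt.eventually ?_)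
    rw [← hA]
    exact ContinuousLinearEquiv.nhds A
  obtain ⟨W, hW, hWo, haW⟩ := eventually_nhds_iff.1 hev
  -- Restricting to the open set where `f` is smooth with invertible differential makes the inverse
  -- smooth on the whole target, not only at the image of `a`.
  let Ψ := (hs.toOpenPartialHomeomorph f).restrOpen W hWo
  have hΨ : ∀ x, Ψ x = f x := fun x => rfl
  have hsrc : ∀ x ∈ Ψ.source, x ∈ W := fun x hx => hx.2
  refine ⟨Ψ, ⟨hs.mem_toOpenPartialHomeomorph_source, haW⟩,
    fun x hx => (hW x (hsrc x hx)).1.contDiffWithinAt, fun z hz => ?_, hΨ⟩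
  have h1 := hW _ (hsrc _ (Ψ.map_target hz))
  obtain ⟨B, hB⟩ := h1.2
  refine (Ψ.contDiffAt_symm (f₀' := B) hz ?_ h1.1).contDiffWithinAt
  rw [hB]
  exact (h1.1.differentiableAt (by simp)).hasFDerivAt

end InverseFunction

/-! ### Existence of straightening coordinates and of the graph function. -/

section Existence

variable {k : ℕ} {Λ : Set (Eucl (k + 1) × Eucl (k + 1))} {x₀ : Eucl (k + 1)}

/-- A defining function of the incidence hypersurface, with a nonzero differential along the
fibre. -/
theorem IsIncidenceHypersurface.exists_definingFunction (hΛ : IsIncidenceHypersurface Λ x₀) :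
    ∃ g : Eucl (k + 1) × Eucl (k + 1) → ℝ, SmoothNear g (x₀, x₀) ∧
      (∀ᶠ q in 𝓝 (x₀, x₀), q ∈ Λ ↔ g q = 0) ∧ ∃ y, fderiv ℝ (fun y => g (x₀, y)) x₀ y ≠ 0 := by
  obtain ⟨hp, U, g, hU, hpU, hg, hd, hiff⟩ := hΛ.hypersurface
  have hgs : SmoothNear g (x₀, x₀) := hg.smoothNear hU hpU
  have hev : ∀ᶠ q in 𝓝 (x₀, x₀), q ∈ Λ ↔ g q = 0 := by
    filter_upwards [hU.mem_nhds hpU] with q hq using hiff q hq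
  refine ⟨g, hgs, hev, ?_⟩
  -- The diagonal lies in `Λ`, so `Dg` kills all `(x, x)`; if it also killed all `(0, y)`, it would
  -- be zero.
  by_contra! hall
  refine hd _ hpU (ContinuousLinearMap.ext fun ⟨x, y⟩ => ?_)
  have h1 : ∀ y, fderiv ℝ g (x₀, x₀) (0, y) = 0 := fun y => by
    rw [← hall y]
    have h2 : HasFDerivAt (fun y : Eucl (k + 1) => (x₀, y))
        (ContinuousLinearMap.inr ℝ (Eucl (k + 1)) (Eucl (k + 1))) x₀ :=
      hasFDerivAt_prodMk_right x₀ x₀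
    have h3 : HasFDerivAt (fun y => g (x₀, y)) ((fderiv ℝ g (x₀, x₀)).comp
        (ContinuousLinearMap.inr ℝ _ _)) x₀ := hgs.differentiableAt.hasFDerivAt.comp x₀ h2
    rw [h3.fderiv]
    rfl
  have h2 : fderiv ℝ g (x₀, x₀) (x, x) = 0 := by
    have h3 : HasFDerivAt (fun y : Eucl (k + 1) => (y, y))
        ((ContinuousLinearMap.id ℝ _).prod (ContinuousLinearMap.id ℝ _)) x₀ :=
      (hasFDerivAt_id x₀).prodMk (hasFDerivAt_id x₀)
    have h4 : (fun y => g (y, y)) =ᶠ[𝓝 x₀] fun _ => 0 := by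
      have h5 : Tendsto (fun y : Eucl (k + 1) => (y, y)) (𝓝 x₀) (𝓝 (x₀, x₀)) :=
        h3.continuousAt.tendsto
      filter_upwards [hΛ.diagonal, h5.eventually hev] with y h6 h7 using h7.1 h6
    have h6 := h4.fderiv_eq (𝕜 := ℝ)
    have h7 : HasFDerivAt (fun y => g (y, y)) ((fderiv ℝ g (x₀, x₀)).comp
        ((ContinuousLinearMap.id ℝ _).prod (ContinuousLinearMap.id ℝ _))) x₀ :=
      HasFDerivAt.comp (g := g) (f := fun y => (y, y)) x₀ hgs.differentiableAt.hasFDerivAt h3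
    rw [h7.fderiv] at h6
    simpa using congrArg (fun A : Eucl (k + 1) →L[ℝ] ℝ => A x) h6
  have h3 : ((x, y) : Eucl (k + 1) × Eucl (k + 1)) = (x, x) + (0, y - x) := by simp
  rw [h3, map_add, h1, h2]
  simp

/-- The projection of `ℝ^{k+1}` that omits the coordinate `i`. -/
noncomputable def omitCoord (i : Fin (k + 1)) : Eucl (k + 1) →L[ℝ] Eucl k :=
  LinearMap.toContinuousLinearMap
    { toFun := fun y => WithLp.toLp 2 fun j => y (i.succAbove j)
      map_add' := fun _ _ => rfl
      map_smul' := fun _ _ => rfl }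

/-- Take `g(x₀, ·)` as last coordinate and, for an index `i` with nonzero `i`-th partial derivative
of it at `x₀`, the remaining components of `y - x₀` as the others. -/
theorem exists_isStraightening (hΛ : IsIncidenceHypersurface Λ x₀) :
    ∃ Φ : OpenPartialHomeomorph (Eucl (k + 1)) (Eucl k × ℝ), IsStraightening Λ x₀ Φ := by
  obtain ⟨g, hg, hev, y₀, hy₀⟩ := hΛ.exists_definingFunction
  have hgx : SmoothNear (fun y => g (x₀, y)) x₀ :=
    hg.comp ((SmoothNear.const x₀).prodMk SmoothNear.id) rfl
  set ℓ := fderiv ℝ (fun y => g (x₀, y)) x₀ with hℓ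
  have hE : ∀ x : Eucl (k + 1), x = ∑ i, x i • EuclideanSpace.single i (1 : ℝ) := fun x => by
    have := (EuclideanSpace.basisFun (Fin (k + 1)) ℝ).sum_repr x
    simpa using this.symm
  obtain ⟨i, hi⟩ : ∃ i, ℓ (EuclideanSpace.single i 1) ≠ 0 := by
    by_contra! hall
    refine hy₀ ?_
    rw [hE y₀, map_sum]
    exact Finset.sum_eq_zero fun i _ => by rw [map_smul, hall i, smul_zero]
  have hF : SmoothNear (fun y => (omitCoord i (y - x₀), g (x₀, y))) x₀ :=
    ((SmoothNear.id.sub (SmoothNear.const x₀)).clm _).prodMk hgx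
  have hF' : HasFDerivAt (fun y => (omitCoord i (y - x₀), g (x₀, y)))
      ((omitCoord i).prod ℓ) x₀ := by
    refine HasFDerivAt.prodMk ?_ hgx.differentiableAt.hasFDerivAt
    exact (omitCoord i).hasFDerivAt.comp x₀ ((hasFDerivAt_id x₀).sub_const x₀)
  obtain ⟨Φ, h1, h2, h3, h4⟩ := exists_openPartialHomeomorph_of_injective_fderiv
    (by simp [Module.finrank_prod]) hF (by
      rw [hF'.fderiv]
      refine (injective_iff_map_eq_zero _).2 fun y hy => ?_
      have h1 : omitCoord i y = 0 := congrArg Prod.fst hy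
      have h2 : ℓ y = 0 := congrArg Prod.snd hy
      have h3 : ∀ j, j ≠ i → y j = 0 := fun j hj => by
        obtain ⟨l, rfl⟩ := Fin.exists_succAbove_eq hj
        exact congrArg (fun z : Eucl k => z l) h1
      have h4 : y = y i • EuclideanSpace.single i 1 := by
        conv_lhs => rw [hE y]
        exact Finset.sum_eq_single i (fun j _ hj => by rw [h3 j hj, zero_smul]) (by simp)
      rw [h4, map_smul, smul_eq_mul] at h2
      rw [h4, (mul_eq_zero.1 h2).resolve_right hi, zero_smul])
  refine ⟨Φ, h1, h2, h3, ?_, ?_⟩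
  · have h5 := hev.self_of_nhds.1 hΛ.diagonal.self_of_nhds
    rw [h4, sub_self, map_zero, h5]
    rfl
  · have h5 : Tendsto (fun y : Eucl (k + 1) => (x₀, y)) (𝓝 x₀) (𝓝 (x₀, x₀)) :=
      tendsto_const_nhds.prodMk_nhds tendsto_id
    filter_upwards [h5.eventually hev] with y hy
    rw [h4]
    exact hy

/-- Solve `g = 0` for `y_n` by inverting `(s, t) ↦ (s, G(s, t))`, where `t` stands for `y_n`; then
`φ = x_n - y_n`. -/
theorem exists_isGraphFunction (hΛ : IsIncidenceHypersurface Λ x₀)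
    {Φ : OpenPartialHomeomorph (Eucl (k + 1)) (Eucl k × ℝ)} (hΦ : IsStraightening Λ x₀ Φ) :
    ∃ φ : (Eucl k × ℝ) × Eucl k → ℝ, IsGraphFunction Λ x₀ Φ φ := by
  obtain ⟨g, hg, hev, y₀, hy₀⟩ := hΛ.exists_definingFunction
  have hp1 : Tendsto (fun q : Eucl (k + 1) × Eucl (k + 1) => q.1) (𝓝 (x₀, x₀)) (𝓝 x₀) :=
    continuous_fst.tendsto _
  have hp2 : Tendsto (fun q : Eucl (k + 1) × Eucl (k + 1) => q.2) (𝓝 (x₀, x₀)) (𝓝 x₀) :=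
    continuous_snd.tendsto _
  have hgy : SmoothNear (fun z => g (x₀, Φ.symm z)) 0 :=
    hg.comp ((SmoothNear.const x₀).prodMk hΦ.smoothNear_symm) (by rw [hΦ.symm_zero])
  -- In the given coordinates `g(x₀, ·)` vanishes on `y_n = 0`, so its differential at `0` is a
  -- multiple of `dy_n`, and it is nonzero.
  have hc : fderiv ℝ (fun z => g (x₀, Φ.symm z)) 0 (0, 1) ≠ 0 := by
    intro hc
    have h1 : ∀ y : Eucl k, fderiv ℝ (fun z => g (x₀, Φ.symm z)) 0 (y, 0) = 0 := fun y => by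
      refine (eventually_fderiv_eq_zero_of_eqOn (K := LinearMap.ker (LinearMap.snd ℝ (Eucl k) ℝ))
        hgy ?_ (a := (y, 0)) rfl).self_of_nhds (Submodule.zero_mem _)
      filter_upwards [hΦ.eventually_target, hΦ.tendsto_symm.eventually hΦ.hyperplane,
        (tendsto_const_nhds.prodMk_nhds hΦ.tendsto_symm).eventually hev] with z h2 h3 h4 hz
      refine h4.1 (h3.2 ?_)
      rw [Φ.right_inv h2]
      exact hz
    have h2 : fderiv ℝ (fun z => g (x₀, Φ.symm z)) 0 = 0 := by
      refine ContinuousLinearMap.ext fun ⟨y, t⟩ => ?_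
      have h3 : ((y, t) : Eucl k × ℝ) = (y, 0) + t • (0, 1) := by simp
      rw [h3, map_add, map_smul, h1, hc]
      simp
    have h3 : (fun y => g (x₀, y)) =ᶠ[𝓝 x₀] fun y => g (x₀, Φ.symm (Φ y)) := by
      filter_upwards [hΦ.eventually_source] with y hy
      rw [Φ.left_inv hy]
    apply hy₀
    rw [h3.fderiv_eq, fderiv_fun_comp (g := fun z => g (x₀, Φ.symm z)) x₀
      (by rw [hΦ.origin]; exact hgy.differentiableAt) hΦ.smoothNear.differentiableAt,
      hΦ.origin, h2]
    simp
  let G : ((Eucl k × ℝ) × Eucl k) × ℝ → ℝ := fun q => g (Φ.symm q.1.1, Φ.symm (q.1.2, q.2))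
  have hG : SmoothNear G 0 := hg.comp
    ((hΦ.smoothNear_symm.comp SmoothNear.id.fst.fst rfl).prodMk
      (hΦ.smoothNear_symm.comp (SmoothNear.id.fst.snd.prodMk SmoothNear.id.snd) rfl))
    (Prod.ext hΦ.symm_zero hΦ.symm_zero)
  have hG0 : G 0 = 0 := by
    have h1 := hev.self_of_nhds.1 hΛ.diagonal.self_of_nhds
    rw [← h1]
    exact congrArg g (Prod.ext hΦ.symm_zero hΦ.symm_zero)
  have hGt : fderiv ℝ G 0 (0, 1) = fderiv ℝ (fun z => g (x₀, Φ.symm z)) 0 (0, 1) := by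
    let j : Eucl k × ℝ →L[ℝ] ((Eucl k × ℝ) × Eucl k) × ℝ :=
      ((ContinuousLinearMap.inr ℝ _ _).comp (ContinuousLinearMap.fst ℝ _ _)).prod
        (ContinuousLinearMap.snd ℝ _ _)
    have h1 : (fun z => g (x₀, Φ.symm z)) = fun z => G (j z) := by
      funext z
      change _ = g (Φ.symm 0, Φ.symm z)
      rw [hΦ.symm_zero]
    rw [h1, fderiv_fun_comp (0 : Eucl k × ℝ) (by simpa using hG.differentiableAt)
      j.differentiableAt, map_zero, j.fderiv]
    simp [j]
    rfl
  have hH : SmoothNear (fun q => (q.1, G q)) 0 := SmoothNear.id.fst.prodMk hG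
  obtain ⟨Ψ, h1, h2, h3, h4⟩ := exists_openPartialHomeomorph_of_injective_fderiv rfl hH (by
    rw [(hasFDerivAt_fst.prodMk hG.differentiableAt.hasFDerivAt).fderiv]
    refine (injective_iff_map_eq_zero _).2 ?_
    rintro ⟨w, t⟩ hw
    have h1 : w = 0 := congrArg Prod.fst hw
    have h2 : fderiv ℝ G 0 (w, t) = 0 := congrArg Prod.snd hw
    rw [h1, show ((0, t) : ((Eucl k × ℝ) × Eucl k) × ℝ) = t • (0, 1) by simp, map_smul, hGt,
      smul_eq_mul] at h2
    rw [h1, (mul_eq_zero.1 h2).resolve_right hc]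
    rfl)
  have hΨ0 : Ψ 0 = 0 := by rw [h4, hG0]; rfl
  have ht0 : (0 : ((Eucl k × ℝ) × Eucl k) × ℝ) ∈ Ψ.target := by
    rw [← hΨ0]; exact Ψ.map_source h1
  have hinl : Tendsto (fun s : (Eucl k × ℝ) × Eucl k => (s, (0 : ℝ))) (𝓝 0) (𝓝 0) := by
    have : Continuous (fun s : (Eucl k × ℝ) × Eucl k => (s, (0 : ℝ))) := by fun_prop
    exact this.tendsto 0
  refine ⟨fun s => s.1.2 - (Ψ.symm (s, 0)).2, ?_, ?_⟩
  · exact SmoothNear.id.fst.snd.sub ((h3.smoothNear Ψ.open_target ht0).comp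
      (SmoothNear.id.prodMk (SmoothNear.const 0)) rfl).snd
  · have hz1 : Tendsto (fun p : Eucl (k + 1) × Eucl (k + 1) => (Φ p.1, (Φ p.2).1))
        (𝓝 (x₀, x₀)) (𝓝 0) :=
      (hΦ.tendsto.comp hp1).prodMk_nhds ((continuous_fst.tendsto _).comp (hΦ.tendsto.comp hp2))
    have hz2 : Tendsto (fun p : Eucl (k + 1) × Eucl (k + 1) => (Φ p.2).2) (𝓝 (x₀, x₀)) (𝓝 0) :=
      (continuous_snd.tendsto _).comp (hΦ.tendsto.comp hp2)
    filter_upwards [hev, hp1.eventually hΦ.eventually_source, hp2.eventually hΦ.eventually_source,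
      (hz1.prodMk_nhds hz2).eventually (Ψ.open_source.mem_nhds h1),
      (hinl.comp hz1).eventually (Ψ.open_target.mem_nhds ht0)] with p h5 h6 h7 h8 h9
    change ((Φ p.1, (Φ p.2).1), (0 : ℝ)) ∈ Ψ.target at h9
    set w := (Φ p.1, (Φ p.2).1) with hw
    have h10 : Ψ (w, (Φ p.2).2) = (w, g p) := by
      rw [h4]
      simp only [G, hw, Prod.mk.eta, Φ.left_inv h6, Φ.left_inv h7]
    have h11 : (Ψ.symm (w, 0)).1 = w := by
      have h12 := Ψ.right_inv h9
      rw [h4] at h12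
      exact congrArg Prod.fst h12
    have h12 : g p = 0 ↔ (Φ p.2).2 = (Ψ.symm (w, 0)).2 := by
      constructor
      · intro h13
        rw [h13] at h10
        rw [← h10, Ψ.left_inv h8]
      · intro h13
        have h14 : (w, (Φ p.2).2) = Ψ.symm (w, 0) := Prod.ext h11.symm h13
        rw [h14, Ψ.right_inv h9] at h10
        exact (congrArg Prod.snd h10).symm
    rw [h5, h12]
    constructor <;> intro h13 <;> simp only [hw] at h13 ⊢ <;> linarith

end Existence

theorem proposition9p15 (k : ℕ) (Λ : Set (Eucl (k + 1) × Eucl (k + 1))) (x₀ : Eucl (k + 1))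
    (hΛ : IsIncidenceHypersurface Λ x₀) :
    (CurvatureLambda Λ x₀ ↔
      ¬ TangentToInfiniteOrder (fiberM Λ x₀ ×ˢ fiberM Λ x₀) Λ (x₀, x₀)) ∧
    (∃ Φ : OpenPartialHomeomorph (Eucl (k + 1)) (Eucl k × ℝ), IsStraightening Λ x₀ Φ) ∧
    (∀ Φ : OpenPartialHomeomorph (Eucl (k + 1)) (Eucl k × ℝ), IsStraightening Λ x₀ Φ →
      (∃ φ : (Eucl k × ℝ) × Eucl k → ℝ, IsGraphFunction Λ x₀ Φ φ ∧ fderiv ℝ φ 0 = 0) ∧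
      (∀ φ : (Eucl k × ℝ) × Eucl k → ℝ, IsGraphFunction Λ x₀ Φ φ →
        (CurvatureLambda Λ x₀ ↔ ∃ α β : Fin k → ℕ, mixedPartial α β φ 0 ≠ 0))) := by
  refine ⟨?_, exists_isStraightening hΛ, fun Φ hΦ => ⟨?_, fun φ hφ => ?_⟩⟩
  -- Neither side involves coordinates, so any one choice of `Φ` and `φ` serves to compare both with
  -- flatness.
  · obtain ⟨Φ, hΦ⟩ := exists_isStraightening hΛ
    obtain ⟨φ, hφ⟩ := exists_isGraphFunction hΛ hΦ
    rw [curvatureLambda_iff_not_vanishesAlong hφ hΦ hΛ.diagonal,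
      tangentToInfiniteOrder_iff_vanishesAlong hφ hΦ hΛ.diagonal]
  · obtain ⟨φ, hφ⟩ := exists_isGraphFunction hΛ hΦ
    exact ⟨φ, hφ, hφ.fderiv_zero hΦ hΛ.diagonal⟩
  · exact curvatureLambda_iff_exists_mixedPartial hφ hΦ hΛ.diagonal
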